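/- Let $K$ be a field of characteristic zero, $n\ge 2$, $S=K[x_1,\dots,x_n]$, and let $\mathcal A$ be a central arrangement of $r\ge n$ hyperplanes in $K^n$ which is generic, i.e. every $n$ hyperplanes of $\mathcal A$ intersect only at the origin. For $H\in\mathcal A$ fix a linear form $p_H\in S$ defining $H$. Let $D(S)=S\langle\partial_1,\dots,\partial_n\rangle$ be the Weyl algebra, with its action $\ast$ on $S$, put $Q=\prod_{H\in\mathcal A}p_H$ and $D(\mathcal A)=\{\theta\in D(S)\mid \theta\ast\langle Q\rangle\subseteq\langle Q\rangle\}$, and let $D^{(m)}(\mathcal A)$ be the $S$-module of those $\theta\in D(\mathcal A)$ that are homogeneous of order $m$, i.e. of the form $\sum_{|\alpha|=m}f_\alpha\partial^\alpha$ with $f_\alpha\in S$. Let $\epsilon_m=\sum_{|\alpha|=m}\frac{m!}{\alpha!}x^\alpha\partial^\alpha$ be the Euler operator of order $m$. Let $\mathcal A^{(n-1)}$ be the set of subsets of $\mathcal A$ with $n-1$ elements; for $\mathcal H\in\mathcal A^{(n-1)}$ fix a nonzero $\delta_{\mathcal H}\in\sum_{i=1}^nK\partial_i$ with $\delta_{\mathcal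 H}\ast p_H=0$ for all $H\in\mathcal H$, and put $P_{\mathcal H}=\prod_{H\in\mathcal A\setminus\mathcal H}p_H$. Suppose $m<r-n+1$, fix $m$ distinct hyperplanes $H_1,\dots,H_m\in\mathcal A$, and let $$\Xi^{(m)}(\mathcal A)=\{\theta\in D^{(m)}(\mathcal A)\mid \theta\ast(p_{H_1}\cdots p_{H_m})=0\}.$$ Then $$D^{(m)}(\mathcal A)=\Xi^{(m)}(\mathcal A)\oplus S\epsilon_m=\Bigl(\sum_{\mathcal H\in\mathcal A^{(n-1)},\ \mathcal H\cap\{H_1,\dots,H_m\}\ne\emptyset}SP_{\mathcal H}\delta_{\mathcal H}^m\Bigr)\oplus S\epsilon_m .$$ Moreover, the operators $P_{\mathcal H}\delta_{\mathcal H}^m$, for $\mathcal H\in\mathcal A^{(n-1)}$ with $\mathcal H\cap\{H_1,\dots,H_m\}\ne\emptyset$, are pairwise distinct, and the set of them is a minimal generating set of the $S$-module $\Xi^{(m)}(\mathcal A)$: it generates $\Xi^{(m)}(\mathcal A)$ and no proper subset of it does. -/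

import Mathlib

open MvPolynomial
open scoped Nat

/-- The multiplication operator by `f` on the polynomial ring `S = K[x_1, …, x_n]`. -/
noncomputable def mulOp {K : Type*} [Field K] {n : ℕ} (f : MvPolynomial (Fin n) K) :
    Module.End K (MvPolynomial (Fin n) K) :=
  LinearMap.mulLeft K f

/-- The partial derivative `∂_i` as a `K`-linear operator on `S`. -/
noncomputable def partialOp (K : Type*) [Field K] {n : ℕ} (i : Fin n) :
    Module.End K (MvPolynomial (Fin n) K) :=
  (pderiv i : Derivation K (MvPolynomial (Fin n) K) (MvPolynomial (Fin n) K))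

/-- `∂^α = ∂_1^{α_1} ⋯ ∂_n^{α_n}`. -/
noncomputable def partialPow (K : Type*) [Field K] {n : ℕ} (α : Fin n →₀ ℕ) :
    Module.End K (MvPolynomial (Fin n) K) :=
  (List.ofFn fun i : Fin n => partialOp K i ^ α i).prod

/-- The `n`-th Weyl algebra `D(S) = S⟨∂_1, …, ∂_n⟩`, realised (faithfully in characteristic zero)
as an algebra of operators on `S`. -/
noncomputable def weylAlgebra (K : Type*) [Field K] (n : ℕ) :
    Subalgebra K (Module.End K (MvPolynomial (Fin n) K)) :=
  Algebra.adjoin K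
    (Set.range (fun i : Fin n => mulOp (X i : MvPolynomial (Fin n) K)) ∪
      Set.range (fun i : Fin n => partialOp K i))

theorem mulOp_mem_weylAlgebra {K : Type*} [Field K] {n : ℕ} (f : MvPolynomial (Fin n) K) :
    mulOp f ∈ weylAlgebra K n := by
  induction f using MvPolynomial.induction_on with
  | C a =>
    have h : mulOp (C a : MvPolynomial (Fin n) K) = algebraMap K _ a := by
      refine LinearMap.ext fun g => ?_
      simp [mulOp, Module.algebraMap_end_apply, MvPolynomial.smul_eq_C_mul]
    rw [h]
    exact Subalgebra.algebraMap_mem _ a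
  | add p q hp hq =>
    have h : mulOp (p + q) = mulOp p + mulOp q := by
      refine LinearMap.ext fun g => ?_
      simp [mulOp, add_mul]
    rw [h]
    exact add_mem hp hq
  | mul_X p i hp =>
    have h : mulOp (p * X i) = mulOp p * mulOp (X i) := by
      refine LinearMap.ext fun g => ?_
      simp [mulOp]
    rw [h]
    exact mul_mem hp (Algebra.subset_adjoin (Or.inl ⟨i, rfl⟩))

/-- The idealizer `D(I) = {θ ∈ D(S) | θ * I ⊆ I}`, as a left `S`-module. -/
noncomputable def idealizer {K : Type*} [Field K] {n : ℕ} (I : Ideal (MvPolynomial (Fin n) K)) :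
    Submodule (MvPolynomial (Fin n) K) (Module.End K (MvPolynomial (Fin n) K)) where
  carrier := {θ | θ ∈ weylAlgebra K n ∧ ∀ g ∈ I, θ g ∈ I}
  add_mem' := fun ha hb =>
    ⟨add_mem ha.1 hb.1, fun g hg => I.add_mem (ha.2 g hg) (hb.2 g hg)⟩
  zero_mem' := ⟨zero_mem _, fun _ _ => I.zero_mem⟩
  smul_mem' := fun f _ hθ =>
    ⟨mul_mem (mulOp_mem_weylAlgebra f) hθ.1, fun g hg => I.mul_mem_left f (hθ.2 g hg)⟩

/-- `D^{(m)}(S)`: the operators `∑_{|α| = m} f_α ∂^α` with `f_α ∈ S`. -/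
noncomputable def homogeneousOps (K : Type*) [Field K] (n m : ℕ) :
    Submodule (MvPolynomial (Fin n) K) (Module.End K (MvPolynomial (Fin n) K)) :=
  Submodule.span _ {θ | ∃ α : Fin n →₀ ℕ, α.degree = m ∧ θ = partialPow K α}

/-- A central hyperplane arrangement in `K^n`: every member is a linear hyperplane. -/
def IsCentralArrangement {K : Type*} [Field K] {n : ℕ}
    (A : Finset (Submodule K (Fin n → K))) : Prop :=
  ∀ H ∈ A, IsCoatom H

/-- Every `n` hyperplanes of the arrangement intersect only at the origin. -/
def IsGenericArrangement {K : Type*} [Field K] {n : ℕ}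
    (A : Finset (Submodule K (Fin n → K))) : Prop :=
  ∀ B ⊆ A, B.card = n → B.inf id = ⊥

/-- `p` is a linear form whose zero set is `H`. -/
def IsDefiningForm {K : Type*} [Field K] {n : ℕ}
    (H : Submodule K (Fin n → K)) (p : MvPolynomial (Fin n) K) : Prop :=
  p.IsHomogeneous 1 ∧ ∀ v : Fin n → K, v ∈ H ↔ eval v p = 0

/-- `D^{(m)}(A)`: the operators of `D(A) = D(⟨Q⟩)`, `Q = ∏_{H ∈ A} p_H`, that are
homogeneous of order `m`. -/
noncomputable def arrangementOps {K : Type*} [Field K] {n : ℕ}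
    (A : Finset (Submodule K (Fin n → K)))
    (p : Submodule K (Fin n → K) → MvPolynomial (Fin n) K) (m : ℕ) :
    Submodule (MvPolynomial (Fin n) K) (Module.End K (MvPolynomial (Fin n) K)) :=
  idealizer (Ideal.span {∏ H ∈ A, p H}) ⊓ homogeneousOps K n m

/-- `Ξ^{(m)}(A)`, for the set `M = {H_1, …, H_m}` of chosen hyperplanes: the operators of
`D^{(m)}(A)` that kill `p_{H_1} ⋯ p_{H_m}`. -/
noncomputable def xiModule {K : Type*} [Field K] {n : ℕ}
    (A : Finset (Submodule K (Fin n → K)))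
    (p : Submodule K (Fin n → K) → MvPolynomial (Fin n) K) (m : ℕ)
    (M : Finset (Submodule K (Fin n → K))) :
    Submodule (MvPolynomial (Fin n) K) (Module.End K (MvPolynomial (Fin n) K)) where
  carrier := {θ | θ ∈ arrangementOps A p m ∧ θ (∏ H ∈ M, p H) = 0}
  add_mem' := fun ha hb =>
    ⟨add_mem ha.1 hb.1, by rw [LinearMap.add_apply, ha.2, hb.2, add_zero]⟩
  zero_mem' := ⟨zero_mem _, rfl⟩
  smul_mem' := fun f _ hθ =>
    ⟨Submodule.smul_mem _ f hθ.1, by rw [LinearMap.smul_apply, hθ.2, smul_zero]⟩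

/-- The Euler operator of order `m`, `ε_m = ∑_{|α| = m} (m! / α!) x^α ∂^α`. -/
noncomputable def eulerOp (K : Type*) [Field K] (n m : ℕ) :
    Module.End K (MvPolynomial (Fin n) K) :=
  ∑ α ∈ Finset.finsuppAntidiag (Finset.univ : Finset (Fin n)) m,
    (monomial α ((m ! : K) / ∏ i, ((α i)! : K))) • partialPow K α

/-- `δ` is a nonzero element of the space of constant-coefficient derivations
`∑ K ∂_i` killing `p_H` for all `H ∈ T`. -/
def IsDirection {K : Type*} [Field K] {n : ℕ}
    (p : Submodule K (Fin n → K) → MvPolynomial (Fin n) K)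
    (T : Finset (Submodule K (Fin n → K)))
    (δ : Module.End K (MvPolynomial (Fin n) K)) : Prop :=
  δ ∈ Submodule.span K (Set.range fun i : Fin n => partialOp K i) ∧ δ ≠ 0 ∧
    ∀ H ∈ T, δ (p H) = 0

open Classical in
/-- `P_T = ∏_{H ∈ A, H ∉ T} p_H`. -/
noncomputable def coProd {K : Type*} [Field K] {n : ℕ}
    (A : Finset (Submodule K (Fin n → K)))
    (p : Submodule K (Fin n → K) → MvPolynomial (Fin n) K)
    (T : Finset (Submodule K (Fin n → K))) : MvPolynomial (Fin n) K :=
  ∏ H ∈ A \ T, p H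

/-- The sets `T ∈ A^{(n-1)}` of `n - 1` hyperplanes of `A` that meet `M`. -/
def meetingSets {K : Type*} [Field K] {n : ℕ}
    (A M : Finset (Submodule K (Fin n → K))) : Set (Finset (Submodule K (Fin n → K))) :=
  {T | T ⊆ A ∧ T.card = n - 1 ∧ ∃ H ∈ T, H ∈ M}

/-! Write an operator of order `m` as `symbolOp F`, with a symbol `F` in `S[ξ]` homogeneous of
degree `m` in `ξ`. Moving it past the linear form of `v` gives `θ(p_v g) = p_v θ(g) + (∂_v F)(g)`,
where `∂_v` differentiates in `ξ` (`symbolOp_linForm_mul`). As the forms of `A` are pairwise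
non-associate primes, preserving the ideal of `Q` amounts to `p_H ∣ ∂_{v_H} F` for all `H`
(`idealizer_inf_homogeneousOps_eq_map`). The problem becomes one about these logarithmic symbols.

They are found by induction on the order. The quotient of `∂_{v_a} F` by `p_a` is logarithmic, of
order one less, for the arrangement without `a`. If it is a combination of generators there, it can
be integrated: for `a ∉ T`, the derivative of `P_T δ_T^(k+1)` along `v_a` is a nonzero constant
times `p_a` times the generator of `T` for the smaller arrangement. Subtracting the integral leaves
a symbol killed by `∂_{v_a}`. Hence the relative statement `logSymbols_le_span_of_nonempty`, for
symbols killed along a nonempty set `E`. Repeated subtraction enlarges `E` to `n - 1` elements,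
where the symbol is `f` times a power of the linear form of `d_E`, and `P_E ∣ f`. In order one the
quotient is a polynomial, and it must lie in an ideal generated by products of forms; this is the
star configuration statement `mem_span_prod_of_forall_mem`. In `logSymbols_le_span_sup` the index
`a` runs through `M`, and the power of the Euler symbol absorbs the remaining order-zero quotient.

The sum is direct because `ε_m` multiplies a product of `m` linear forms by `m!`, while a generator
whose `T` meets `M` kills the product over `M`. Minimality follows by evaluating at the point `d_T`,
where `P_{T'}` vanishes for every `T' ≠ T` but `P_T` does not. -/

/-! ### Linear forms and directional derivatives of symbols -/

section LinearForms

variable {K : Type*} [Field K] {n : ℕ} (R : Type*) [CommRing R] [Algebra K R]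

/-- The linear form `∑ v_i X_i` attached to a vector `v`. -/
noncomputable def linForm : (Fin n → K) →ₗ[K] MvPolynomial (Fin n) R :=
  Fintype.linearCombination K X

/-- The derivation `∑ v_i ∂/∂X_i` attached to a vector `v`. -/
noncomputable def dirDeriv :
    (Fin n → K) →ₗ[K] Derivation R (MvPolynomial (Fin n) R) (MvPolynomial (Fin n) R) :=
  Fintype.linearCombination K fun i => pderiv i

theorem linForm_apply (v : Fin n → K) : linForm R v = ∑ i, v i • (X i : MvPolynomial (Fin n) R) :=
  Fintype.linearCombination_apply ..

theorem dirDeriv_apply (v : Fin n → K) (F : MvPolynomial (Fin n) R) :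
    dirDeriv R v F = ∑ i, v i • pderiv i F := by
  rw [dirDeriv, Fintype.linearCombination_apply, ← Derivation.coeFnAddMonoidHom_apply, map_sum,
    Finset.sum_apply]
  rfl

theorem dirDeriv_X (v : Fin n → K) (i : Fin n) :
    dirDeriv R v (X i) = algebraMap K (MvPolynomial (Fin n) R) (v i) := by
  classical
  simp [dirDeriv_apply, pderiv_X, Pi.single_apply, Algebra.algebraMap_eq_smul_one]

theorem dirDeriv_linForm (v d : Fin n → K) :
    dirDeriv R v (linForm R d) = algebraMap K (MvPolynomial (Fin n) R) (d ⬝ᵥ v) := by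
  simp_rw [linForm_apply, map_sum, dotProduct, Derivation.map_smul_of_tower, dirDeriv_X,
    map_sum, map_mul, Algebra.smul_def]

theorem isHomogeneous_linForm (v : Fin n → K) : (linForm R v).IsHomogeneous 1 := by
  rw [linForm_apply]
  refine IsHomogeneous.sum _ _ _ fun i _ => ?_
  have h : v i • (X i : MvPolynomial (Fin n) R) = C (algebraMap K R (v i)) * X i := by
    rw [← smul_eq_C_mul, algebraMap_smul]
  rw [h]
  exact (isHomogeneous_X R i).C_mul _

theorem isHomogeneous_dirDeriv {F : MvPolynomial (Fin n) R} {k : ℕ} (hF : F.IsHomogeneous k)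
    (v : Fin n → K) : (dirDeriv R v F).IsHomogeneous (k - 1) := by
  rw [dirDeriv_apply]
  refine IsHomogeneous.sum _ _ _ fun i _ => ?_
  rw [← algebraMap_smul R, smul_eq_C_mul]
  exact hF.pderiv.C_mul _

theorem dirDeriv_C (v : Fin n → K) (f : R) : dirDeriv R v (C f) = 0 := by
  simp

theorem dirDeriv_C_mul (v : Fin n → K) (f : R) (F : MvPolynomial (Fin n) R) :
    dirDeriv R v (C f * F) = C f * dirDeriv R v F := by
  rw [← smul_eq_C_mul, Derivation.map_smul, smul_eq_C_mul]

theorem dirDeriv_pow (v : Fin n → K) (F : MvPolynomial (Fin n) R) (k : ℕ) :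
    dirDeriv R v (F ^ k) = C (k : R) * F ^ (k - 1) * dirDeriv R v F := by
  rw [Derivation.leibniz_pow]
  simp [mul_assoc]

/-- A submodule containing the derivatives of `F` along `s` contains those along the span of `s`. -/
theorem dirDeriv_mem_of_mem_span {s : Set (Fin n → K)} {F : MvPolynomial (Fin n) R}
    (N : Submodule R (MvPolynomial (Fin n) R)) (hs : ∀ v ∈ s, dirDeriv R v F ∈ N)
    {v : Fin n → K} (hv : v ∈ Submodule.span K s) : dirDeriv R v F ∈ N := by
  induction hv using Submodule.span_induction with
  | mem x hx => exact hs x hx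
  | zero => simp
  | add x y _ _ hx hy => rw [map_add]; exact N.add_mem hx hy
  | smul a x _ hx =>
    rw [map_smul, Derivation.smul_apply, ← algebraMap_smul R]
    exact N.smul_mem _ hx

theorem dirDeriv_comm (v w : Fin n → K) (F : MvPolynomial (Fin n) R) :
    dirDeriv R v (dirDeriv R w F) = dirDeriv R w (dirDeriv R v F) := by
  have h : ⁅dirDeriv R v, dirDeriv R w⁆ = 0 := by
    refine derivation_ext fun i => ?_
    rw [Derivation.commutator_apply, dirDeriv_X, dirDeriv_X,
      MvPolynomial.algebraMap_apply, MvPolynomial.algebraMap_apply]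
    simp
  have h1 := DFunLike.congr_fun h F
  rw [Derivation.commutator_apply] at h1
  exact sub_eq_zero.1 h1

theorem eval_algebraMap_linForm (w d : Fin n → K) :
    eval (fun i => algebraMap K R (w i)) (linForm R d) = algebraMap K R (d ⬝ᵥ w) := by
  have h : ∀ i, d i • (X i : MvPolynomial (Fin n) R) = C (algebraMap K R (d i)) * X i := fun i => by
    rw [← smul_eq_C_mul, algebraMap_smul]
  simp_rw [linForm_apply, h, map_sum, map_mul, eval_C, eval_X, dotProduct, map_sum, map_mul]

theorem dirDeriv_single (i : Fin n) (F : MvPolynomial (Fin n) R) :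
    dirDeriv R (Pi.single i (1 : K)) F = pderiv i F := by
  classical
  rw [dirDeriv_apply, Finset.sum_eq_single i]
  · simp
  · intro j _ hj; simp [hj]
  · simp

variable (K) in
/-- In characteristic zero, a form of positive degree is divisible by a constant dividing all of its
partial derivatives. -/
theorem C_dvd_of_C_dvd_pderiv [CharZero K] {F : MvPolynomial (Fin n) R} {k : ℕ}
    (hF : F.IsHomogeneous (k + 1)) {q : R} (h : ∀ i, C q ∣ pderiv i F) : C q ∣ F := by
  have h1 : C q ∣ ((k + 1 : ℕ) : K) • F := by
    rw [Nat.cast_smul_eq_nsmul, ← hF.sum_X_mul_pderiv]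
    exact Finset.dvd_sum fun i _ => (h i).mul_left _
  have h2 : ((k + 1 : ℕ) : K) ≠ 0 := Nat.cast_ne_zero.2 k.succ_ne_zero
  obtain ⟨G, hG⟩ := h1
  refine ⟨((k + 1 : ℕ) : K)⁻¹ • G, ?_⟩
  rw [mul_smul_comm, ← hG, smul_smul, inv_mul_cancel₀ h2, one_smul]

theorem eq_C_of_isHomogeneous_zero {F : MvPolynomial (Fin n) R} (hF : F.IsHomogeneous 0) :
    F = C (coeff 0 F) :=
  totalDegree_eq_zero_iff_eq_C.1 (Nat.le_zero.1 hF.totalDegree_le)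

/-- A form killed by the derivatives along the hyperplane orthogonal to `d` is a multiple of a
power of the linear form of `d`. -/
theorem exists_eq_C_mul_linForm_pow [CharZero K] {s : Set (Fin n → K)}
    {d w : Fin n → K} (hd : ∀ v ∈ s, d ⬝ᵥ v = 0) (hw : d ⬝ᵥ w ≠ 0)
    (hs : Submodule.span K (insert w s) = ⊤) {k : ℕ} {F : MvPolynomial (Fin n) R}
    (hF : F.IsHomogeneous k) (h : ∀ v ∈ s, dirDeriv R v F = 0) :
    ∃ f : R, F = C f * linForm R d ^ k := by
  induction k generalizing F with
  | zero => exact ⟨_, by simpa using eq_C_of_isHomogeneous_zero R hF⟩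
  | succ k ih =>
    obtain ⟨f, hf⟩ := ih (isHomogeneous_dirDeriv R hF w) fun v hv => by rw [dirDeriv_comm, h v hv, map_zero]
    -- The derivative of the `(k+1)`-st power of the form along `w` is `a` times its `k`-th power,
    -- so dividing by `a` integrates `hf`.
    set a : K := (((k + 1 : ℕ) : K) * (d ⬝ᵥ w)) with ha
    have ha0 : a ≠ 0 := mul_ne_zero (Nat.cast_ne_zero.2 k.succ_ne_zero) hw
    refine ⟨algebraMap K R a⁻¹ * f, ?_⟩
    rw [← sub_eq_zero]
    set G := F - C (algebraMap K R a⁻¹ * f) * linForm R d ^ (k + 1) with hG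
    have hGd : ∀ v : Fin n → K, dirDeriv R v G = dirDeriv R v F - C (algebraMap K R a⁻¹ * f) *
        (C ((k + 1 : ℕ) : R) * linForm R d ^ k * algebraMap K (MvPolynomial (Fin n) R) (d ⬝ᵥ v)) := by
      intro v
      rw [hG, map_sub, dirDeriv_C_mul, dirDeriv_pow, dirDeriv_linForm, Nat.add_sub_cancel]
    have hG0 : ∀ v ∈ insert w s, dirDeriv R v G ∈ (⊥ : Submodule R (MvPolynomial (Fin n) R)) := by
      intro v hv
      rw [Submodule.mem_bot, hGd]
      rcases hv with rfl | hv
      · have h1 : C ((k + 1 : ℕ) : R) * algebraMap K (MvPolynomial (Fin n) R) (d ⬝ᵥ v)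
            = C (algebraMap K R a) := by
          rw [ha, map_mul, map_mul, map_natCast, map_natCast, map_natCast, MvPolynomial.algebraMap_apply]
        have h2 : (C (algebraMap K R a⁻¹) : MvPolynomial (Fin n) R) * C (algebraMap K R a) = 1 := by
          rw [← map_mul, ← map_mul, inv_mul_cancel₀ ha0, map_one, map_one]
        rw [hf, map_mul]
        linear_combination (- C (algebraMap K R a⁻¹) * C f * linForm R d ^ k) * h1
          - C f * linForm R d ^ k * h2
      · rw [h v hv, hd v hv]; simp
    have hGh : G.IsHomogeneous (k + 1) := by
      refine hF.sub (IsHomogeneous.C_mul ?_ _)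
      simpa using (isHomogeneous_linForm R d).pow (k + 1)
    -- Vanishing is treated as divisibility by `0`: the derivatives of `G` vanish along a spanning
    -- set, hence all partial derivatives do.
    refine zero_dvd_iff.1 ?_
    rw [← C_0]
    refine C_dvd_of_C_dvd_pderiv K R hGh fun i => ?_
    rw [C_0, zero_dvd_iff, ← dirDeriv_single (K := K), ← Submodule.mem_bot R]
    exact dirDeriv_mem_of_mem_span R _ hG0 (hs ▸ Submodule.mem_top)

end LinearForms

/-! ### Regularity and primality modulo linear forms -/

section Regularity

variable {K : Type*} [Field K] {n : ℕ}

theorem linForm_injective : Function.Injective (linForm K : (Fin n → K) → MvPolynomial (Fin n) K) := by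
  intro v w h
  funext i
  have := congrArg (coeff (Finsupp.single i 1)) h
  classical
  simpa [linForm_apply, coeff_sum, coeff_X, coeff_smul, Finsupp.single_left_inj] using this

theorem eval_linForm (x v : Fin n → K) : eval x (linForm K v) = v ⬝ᵥ x := by
  simp [linForm_apply, dotProduct, smul_eq_C_mul]

/-- Substituting along a projection with kernel spanned by `s` gives a domain quotient. -/
theorem exists_algHom_of_span (s : Set (Fin n → K)) :
    ∃ τ : MvPolynomial (Fin n) K →ₐ[K] MvPolynomial (Fin n) K,
      (∀ f, f - τ f ∈ Ideal.span (linForm K '' s)) ∧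
      (∀ f ∈ Ideal.span (linForm K '' s), τ f = 0) ∧
      ∀ v, v ∉ Submodule.span K s → τ (linForm K v) ≠ 0 := by
  -- The substitution is induced by the projection `π` onto a complement of the span; its values lie
  -- in a domain, so its kernel is prime.
  obtain ⟨W, hW⟩ := (Submodule.span K s).exists_isCompl
  obtain ⟨π, hπ1, hπ2⟩ : ∃ π : (Fin n → K) →ₗ[K] (Fin n → K),
      (∀ v, π v = 0 ↔ v ∈ Submodule.span K s) ∧ ∀ v, v - π v ∈ Submodule.span K s := by
    refine ⟨W.subtype ∘ₗ W.projectionOnto _ hW.symm, fun v => ?_, fun v => ?_⟩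
    · simp
    · rw [← Submodule.projectionOnto_apply_eq_zero_iff hW.symm, map_sub, LinearMap.comp_apply,
        Submodule.subtype_apply, Submodule.projectionOnto_apply_left, sub_self]
  have hlin : ∀ v ∈ Submodule.span K s, linForm K v ∈ Ideal.span (linForm K '' s) := by
    intro v hv
    induction hv using Submodule.span_induction with
    | mem x hx => exact Ideal.subset_span ⟨x, hx, rfl⟩
    | zero => simp
    | add x y _ _ hx hy => rw [map_add]; exact Ideal.add_mem _ hx hy
    | smul a x _ hx => rw [map_smul, smul_eq_C_mul]; exact Ideal.mul_mem_left _ _ hx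
  set τ : MvPolynomial (Fin n) K →ₐ[K] MvPolynomial (Fin n) K :=
    aeval fun i => linForm K (π (Pi.single i 1)) with hτ
  have hτl : ∀ v, τ (linForm K v) = linForm K (π v) := by
    intro v
    have hv : v = ∑ i, v i • (Pi.single i (1 : K) : Fin n → K) := by
      funext j; simp [Finset.sum_apply, Pi.single_apply]
    conv_rhs => rw [hv]
    simp_rw [map_sum, map_smul]
    simp [linForm_apply K v, hτ]
  refine ⟨τ, fun f => ?_, fun f hf => ?_, fun v hv => ?_⟩
  · rw [← Ideal.Quotient.eq]
    have h : Ideal.Quotient.mkₐ K (Ideal.span (linForm K '' s)) =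
        (Ideal.Quotient.mkₐ K (Ideal.span (linForm K '' s))).comp τ := by
      refine algHom_ext fun i => ?_
      have hX : (X i : MvPolynomial (Fin n) K) = linForm K (Pi.single i (1 : K)) := by
        simp [linForm_apply, Pi.single_apply, ite_smul]
      simp only [AlgHom.comp_apply, Ideal.Quotient.mkₐ_eq_mk]
      rw [Ideal.Quotient.eq, hX, hτl, ← map_sub]
      exact hlin _ (hπ2 _)
    exact DFunLike.congr_fun h f
  · have : Ideal.span (linForm K '' s) ≤ RingHom.ker τ := by
      rw [Ideal.span_le]
      rintro _ ⟨v, hv, rfl⟩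
      rw [SetLike.mem_coe, RingHom.mem_ker, hτl, (hπ1 v).2 (Submodule.subset_span hv), map_zero]
    exact this hf
  · rw [hτl, Ne, ← map_zero (linForm K : (Fin n → K) →ₗ[K] _), linForm_injective.eq_iff]
    exact fun h => hv ((hπ1 v).1 h)

/-- A linear form outside an ideal generated by linear forms is a nonzerodivisor modulo it. -/
theorem mem_span_of_linForm_mul_mem {s : Set (Fin n → K)} {v : Fin n → K}
    (hv : v ∉ Submodule.span K s) {f : MvPolynomial (Fin n) K}
    (h : linForm K v * f ∈ Ideal.span (linForm K '' s)) : f ∈ Ideal.span (linForm K '' s) := by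
  obtain ⟨τ, h1, h2, h3⟩ := exists_algHom_of_span s
  have h4 := h2 _ h
  rw [map_mul, mul_eq_zero, or_iff_right (h3 v hv)] at h4
  simpa [h4] using h1 f

theorem prime_linForm {v : Fin n → K} (hv : v ≠ 0) : Prime (linForm K v) := by
  obtain ⟨τ, h1, h2, -⟩ := exists_algHom_of_span {v}
  simp only [Set.image_singleton, Ideal.mem_span_singleton] at h1 h2
  refine ⟨?_, fun hu => ?_, fun a b hab => ?_⟩
  · rw [← map_zero (linForm K : (Fin n → K) →ₗ[K] _)]; exact linForm_injective.ne hv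
  · simpa using h2 1 hu.dvd
  · have h4 := h2 _ hab
    rw [map_mul, mul_eq_zero] at h4
    refine h4.imp (fun h => ?_) fun h => ?_
    · simpa [h] using h1 a
    · simpa [h] using h1 b

theorem not_linForm_dvd_linForm {v w : Fin n → K} (h : w ∉ Submodule.span K {v}) :
    ¬ linForm K v ∣ linForm K w := by
  obtain ⟨τ, -, h2, h3⟩ := exists_algHom_of_span {v}
  simp only [Set.image_singleton, Ideal.mem_span_singleton] at h2
  exact fun hd => h3 w h (h2 _ hd)

end Regularity

/-! ### Ideals of star configurations -/

section StarConfiguration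

/-- The intersection of the ideals generated by `d` of the elements `p_i`, `i ∈ s`, is generated by
the products of `|s| + 1 - d` of them, provided that every `p_i` is a nonzerodivisor modulo `d`
others. -/
theorem mem_span_prod_of_forall_mem {R ι : Type*} [CommRing R] [DecidableEq ι] (p : ι → R)
    (s : Finset ι) (d : ℕ) (J : Ideal R)
    (hreg : ∀ B ⊆ s, B.card = d → ∀ i ∈ s, i ∉ B → ∀ h,
      p i * h ∈ J ⊔ Ideal.span (p '' B) → h ∈ J ⊔ Ideal.span (p '' B))
    (g : R) (hg : ∀ B ⊆ s, B.card = d → g ∈ J ⊔ Ideal.span (p '' B)) :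
    g ∈ J ⊔ Ideal.span {x | ∃ W ⊆ s, W.card = s.card + 1 - d ∧ x = ∏ i ∈ W, p i} := by
  induction s using Finset.induction_on generalizing d J g with
  | empty =>
    rcases d with _ | d
    · exact Ideal.mem_sup_left (by simpa using hg ∅ le_rfl rfl)
    · refine Ideal.mem_sup_right ?_
      rw [← mul_one g]
      refine Ideal.mul_mem_left _ g (Ideal.subset_span ?_)
      exact ⟨∅, le_rfl, by simp, by simp⟩
  | insert a s ha ih =>
    rcases d with _ | d
    · exact Ideal.mem_sup_left (by simpa using hg ∅ (by simp) rfl)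
    rw [Finset.card_insert_of_notMem ha]
    -- If `s.card < d` there is no `B` to test, and the truncated subtraction gives `0`: the empty
    -- product generates the unit ideal.
    rcases lt_or_ge s.card d with hd | hd
    · refine Ideal.mem_sup_right ?_
      rw [← mul_one g]
      refine Ideal.mul_mem_left _ g (Ideal.subset_span ?_)
      exact ⟨∅, by simp, by rw [Finset.card_empty]; omega, by simp⟩
    have hspan : ∀ B : Finset ι, J ⊔ Ideal.span (p '' ↑(insert a B)) =
        (J ⊔ Ideal.span {p a}) ⊔ Ideal.span (p '' B) := by
      intro B
      rw [Finset.coe_insert, Set.image_insert_eq, Ideal.span_insert, sup_assoc]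
    -- Testing only the sets `B` that contain `a` gives `g = z + p a * h`, with `z` already of the
    -- desired shape.
    have h1 := ih d (J ⊔ Ideal.span {p a})
      (fun B hB hBd i hi hiB h hh => by
        rw [← hspan] at hh ⊢
        refine hreg (insert a B) (Finset.insert_subset_insert a hB) ?_ i
          (Finset.mem_insert_of_mem hi) ?_ h hh
        · rw [Finset.card_insert_of_notMem (fun h => ha (hB h)), hBd]
        · rw [Finset.mem_insert, not_or]
          exact ⟨fun h => ha (h ▸ hi), hiB⟩) g
      (fun B hB hBd => by
        rw [← hspan]
        refine hg _ (Finset.insert_subset_insert a hB) ?_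
        rw [Finset.card_insert_of_notMem (fun h => ha (hB h)), hBd])
    rw [sup_right_comm, Submodule.mem_sup] at h1
    obtain ⟨z, hz, y, hy, rfl⟩ := h1
    obtain ⟨h, rfl⟩ := Ideal.mem_span_singleton.1 hy
    -- For `B ⊆ s` with `d + 1` elements, every product occurring in `z` has a factor indexed by
    -- `B`, by counting. So `p a * h` lies in the ideal of `B`, and regularity of `p a` gives the
    -- same for `h`.
    have h2 := ih (d + 1) J
      (fun B hB hBd i hi hiB => hreg B (hB.trans (Finset.subset_insert a s)) hBd i
        (Finset.mem_insert_of_mem hi) hiB) h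
      (fun B hB hBd => by
        refine hreg B (hB.trans (Finset.subset_insert a s)) hBd a (Finset.mem_insert_self a s)
          (fun h => ha (hB h)) h ?_
        have h3 := hg B (hB.trans (Finset.subset_insert a s)) hBd
        refine (Ideal.add_mem_iff_right _ ?_).1 h3
        refine (sup_le_sup_left (Ideal.span_le.2 ?_) J) hz
        rintro _ ⟨W, hW, hWc, rfl⟩
        obtain ⟨i, hi⟩ : (W ∩ B).Nonempty := by
          rw [← Finset.card_pos]
          have := Finset.card_union_add_card_inter W B
          have h4 := Finset.card_le_card (Finset.union_subset hW hB)
          have h5 := Finset.card_le_card hB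
          omega
        rw [Finset.mem_inter] at hi
        exact Ideal.mem_of_dvd _ (Finset.dvd_prod_of_mem p hi.1)
          (Ideal.subset_span ⟨i, hi.2, rfl⟩))
    refine Ideal.add_mem _ ((sup_le_sup_left (Ideal.span_mono ?_) J) hz) ?_
    · rintro _ ⟨W, hW, hWc, rfl⟩
      exact ⟨W, hW.trans (Finset.subset_insert a s), by omega, rfl⟩
    · rw [Submodule.mem_sup] at h2
      obtain ⟨u, hu, w, hw, rfl⟩ := h2
      rw [mul_add]
      clear hy hg
      refine Ideal.add_mem _ (Ideal.mem_sup_left (J.mul_mem_left _ hu)) (Ideal.mem_sup_right ?_)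
      induction hw using Submodule.span_induction with
      | mem x hx =>
        obtain ⟨W, hW, hWc, rfl⟩ := hx
        have haW : a ∉ W := fun h => ha (hW h)
        refine Ideal.subset_span ⟨insert a W, Finset.insert_subset_insert a hW, ?_, ?_⟩
        · rw [Finset.card_insert_of_notMem haW]; omega
        · rw [Finset.prod_insert haW]
      | zero => simp
      | add x y _ _ hx hy => rw [mul_add]; exact Ideal.add_mem _ hx hy
      | smul c x _ hx =>
        rw [smul_eq_mul, mul_left_comm]; exact Ideal.mul_mem_left _ _ hx

end StarConfiguration

/-! ### Differential operators and their symbols -/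

section SymbolOperators

variable {K : Type*} [Field K] {n : ℕ}

theorem partialOp_comm (i j : Fin n) : partialOp K i * partialOp K j = partialOp K j * partialOp K i := by
  have h : ⁅(pderiv i : Derivation K (MvPolynomial (Fin n) K) (MvPolynomial (Fin n) K)),
      (pderiv j : Derivation K (MvPolynomial (Fin n) K) (MvPolynomial (Fin n) K))⁆ = 0 := by
    classical
    refine derivation_ext fun k => ?_
    rw [Derivation.commutator_apply, pderiv_X, pderiv_X]
    simp only [Pi.single_apply, apply_ite (pderiv i), apply_ite (pderiv j)]
    simp
  refine LinearMap.ext fun f => ?_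
  have h1 := DFunLike.congr_fun h f
  rw [Derivation.commutator_apply] at h1
  exact sub_eq_zero.1 h1

universe u

open scoped IsMulCommutative in
/-- The operators `∂^α` are the monomials in commuting elements of a commutative ring. -/
theorem exists_ringHom_partialPow (K : Type u) [Field K] (n : ℕ) :
    ∃ (B : Type u) (_ : CommRing B) (b : Fin n → B)
      (τ : B →+* Module.End K (MvPolynomial (Fin n) K)), (∀ i, τ (b i) = partialOp K i) ∧
        ∀ α, partialPow K α = τ (∏ i, b i ^ α i) := by
  have hB : IsMulCommutative (Algebra.adjoin K (Set.range fun i : Fin n => partialOp K i)) :=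
    Algebra.isMulCommutative_adjoin K (by
      rintro _ ⟨i, rfl⟩ _ ⟨j, rfl⟩
      exact partialOp_comm i j)
  refine ⟨Algebra.adjoin K (Set.range fun i : Fin n => partialOp K i), inferInstance,
    fun i => ⟨partialOp K i, Algebra.subset_adjoin ⟨i, rfl⟩⟩,
    (Subalgebra.val _ : _ →ₐ[K] _).toRingHom, fun i => rfl, fun α => ?_⟩
  rw [← List.prod_ofFn, map_list_prod, List.map_ofFn]
  rfl

theorem partialPow_add (α β : Fin n →₀ ℕ) :
    partialPow K (α + β) = partialPow K α * partialPow K β := by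
  obtain ⟨B, _, b, τ, -, h⟩ := exists_ringHom_partialPow K n
  rw [h, h, h, ← map_mul, ← Finset.prod_mul_distrib]
  simp [pow_add]

theorem partialPow_zero : partialPow K (0 : Fin n →₀ ℕ) = 1 := by
  simp [partialPow]

theorem partialPow_single (i : Fin n) : partialPow K (Finsupp.single i 1) = partialOp K i := by
  classical
  obtain ⟨B, _, b, τ, hb, h⟩ := exists_ringHom_partialPow K n
  rw [h, Finset.prod_eq_single i, Finsupp.single_eq_same, pow_one, hb]
  · intro j _ hj
    rw [Finsupp.single_eq_of_ne hj, pow_zero]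
  · simp

theorem partialPow_one_eq_zero {α : Fin n →₀ ℕ} (hα : α ≠ 0) :
    partialPow K α (1 : MvPolynomial (Fin n) K) = 0 := by
  obtain ⟨i, hi⟩ := Finsupp.ne_iff.1 hα
  have h : α = (α - Finsupp.single i 1) + Finsupp.single i 1 :=
    (tsub_add_cancel_of_le (Finsupp.single_le_iff.2 (Nat.one_le_iff_ne_zero.2 hi))).symm
  rw [h, partialPow_add, partialPow_single, Module.End.mul_apply]
  have h1 : partialOp K i (1 : MvPolynomial (Fin n) K) = 0 :=
    Derivation.map_one_eq_zero (pderiv i)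
  rw [h1, map_zero]

/-- The differential operator `∑ f_α ∂^α` with symbol `∑ f_α ξ^α`. -/
noncomputable def symbolOp : MvPolynomial (Fin n) (MvPolynomial (Fin n) K) →ₗ[MvPolynomial (Fin n) K]
    Module.End K (MvPolynomial (Fin n) K) :=
  (basisMonomials (Fin n) (MvPolynomial (Fin n) K)).constr (MvPolynomial (Fin n) K) (partialPow K)

theorem symbolOp_monomial (α : Fin n →₀ ℕ) (f : MvPolynomial (Fin n) K) :
    symbolOp (monomial α f) = f • partialPow K α := by
  have h : monomial α f = f • basisMonomials (Fin n) (MvPolynomial (Fin n) K) α := by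
    simp [smul_monomial]
  rw [h, map_smul, symbolOp, Module.Basis.constr_basis]

theorem symbolOp_C (f : MvPolynomial (Fin n) K) : symbolOp (C f) = mulOp f := by
  rw [← monomial_zero', symbolOp_monomial, partialPow_zero]
  rfl

theorem symbolOp_C_mul (f : MvPolynomial (Fin n) K) (F : MvPolynomial (Fin n) (MvPolynomial (Fin n) K)) :
    symbolOp (C f * F) = f • symbolOp F := by
  rw [← smul_eq_C_mul, map_smul]

theorem symbolOp_mul_X (F : MvPolynomial (Fin n) (MvPolynomial (Fin n) K)) (i : Fin n) :
    symbolOp (F * X i) = symbolOp F * partialOp K i := by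
  induction F using MvPolynomial.induction_on' with
  | monomial α f =>
    rw [X, monomial_mul, mul_one, symbolOp_monomial, symbolOp_monomial, partialPow_add,
      partialPow_single, smul_mul_assoc]
  | add p q hp hq => rw [add_mul, map_add, map_add, add_mul, hp, hq]

theorem symbolOp_mul_linForm (F : MvPolynomial (Fin n) (MvPolynomial (Fin n) K)) (d : Fin n → K) :
    symbolOp (F * linForm (MvPolynomial (Fin n) K) d) =
      symbolOp F * ∑ i, d i • partialOp K i := by
  simp_rw [linForm_apply, Finset.mul_sum, map_sum, mul_smul_comm, ← symbolOp_mul_X]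
  refine Finset.sum_congr rfl fun i _ => ?_
  rw [← algebraMap_smul (MvPolynomial (Fin n) K), map_smul, algebraMap_smul]

theorem symbolOp_linForm_pow (d : Fin n → K) (m : ℕ) :
    symbolOp (linForm (MvPolynomial (Fin n) K) d ^ m) = (∑ i, d i • partialOp K i) ^ m := by
  induction m with
  | zero => rw [pow_zero, pow_zero, ← C_1, symbolOp_C]; ext; simp [mulOp]
  | succ m ih => rw [pow_succ, symbolOp_mul_linForm, ih, pow_succ]

theorem partialOp_linForm_mul (i : Fin n) (v : Fin n → K) (g : MvPolynomial (Fin n) K) :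
    partialOp K i (linForm K v * g) = v i • g + linForm K v * partialOp K i g := by
  classical
  have h : pderiv i (linForm K v) = C (v i) := by
    simp [linForm_apply, pderiv_X, Pi.single_apply, smul_eq_C_mul]
  change pderiv i _ = _ + _ * pderiv i _
  rw [Derivation.leibniz, h, smul_eq_C_mul, smul_eq_mul, smul_eq_mul]
  ring

/-- Commuting a differential operator past a linear form differentiates its symbol. -/
theorem symbolOp_linForm_mul (F : MvPolynomial (Fin n) (MvPolynomial (Fin n) K)) (v : Fin n → K)
    (g : MvPolynomial (Fin n) K) :
    symbolOp F (linForm K v * g) = linForm K v * symbolOp F g +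
      symbolOp (dirDeriv (MvPolynomial (Fin n) K) v F) g := by
  induction F using MvPolynomial.induction_on generalizing g with
  | C f => simp [symbolOp_C, mulOp, mul_left_comm]
  | add p q hp hq => simp only [map_add, LinearMap.add_apply, hp, hq]; ring
  | mul_X F i hF =>
    rw [symbolOp_mul_X, Module.End.mul_apply, partialOp_linForm_mul, map_add, hF, Derivation.leibniz,
      dirDeriv_X, map_add, smul_eq_mul, smul_eq_mul, mul_comm (X i), symbolOp_mul_X,
      MvPolynomial.algebraMap_apply, mul_comm F, symbolOp_C_mul]
    simp only [LinearMap.add_apply, Module.End.mul_apply, map_smul, LinearMap.smul_apply]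
    rw [algebraMap_eq, smul_eq_C_mul, smul_eq_mul]
    ring

theorem symbolOp_mem_weylAlgebra (F : MvPolynomial (Fin n) (MvPolynomial (Fin n) K)) :
    symbolOp F ∈ weylAlgebra K n := by
  induction F using MvPolynomial.induction_on with
  | C f => rw [symbolOp_C]; exact mulOp_mem_weylAlgebra f
  | add p q hp hq => rw [map_add]; exact add_mem hp hq
  | mul_X F i hF =>
    rw [symbolOp_mul_X]
    exact mul_mem hF (Algebra.subset_adjoin (Or.inr ⟨i, rfl⟩))

theorem homogeneousOps_eq_map (m : ℕ) : homogeneousOps K n m =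
    (homogeneousSubmodule (Fin n) (MvPolynomial (Fin n) K) m).map symbolOp := by
  refine le_antisymm (Submodule.span_le.2 ?_) ?_
  · rintro _ ⟨α, hα, rfl⟩
    refine ⟨monomial α 1, isHomogeneous_monomial 1 hα, ?_⟩
    rw [symbolOp_monomial, one_smul]
  · rw [Submodule.map_le_iff_le_comap]
    intro F hF
    rw [Submodule.mem_comap, F.as_sum, map_sum]
    refine Submodule.sum_mem _ fun α hα => ?_
    rw [symbolOp_monomial]
    refine Submodule.smul_mem _ _ (Submodule.subset_span ⟨α, ?_, rfl⟩)
    have := hF (mem_support_iff.1 hα)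
    rw [← this, Finsupp.degree_eq_weight_one]; rfl

/-- A differential operator mapping multiples of `u` into the ideal of a divisor coprime to `u`
has symbol divisible by that divisor. -/
theorem C_dvd_of_symbolOp_mul [CharZero K] {q u : MvPolynomial (Fin n) K}
    (hq : ∀ f, q ∣ u * f → q ∣ f) {m : ℕ} {F : MvPolynomial (Fin n) (MvPolynomial (Fin n) K)}
    (hF : F.IsHomogeneous m) (h : ∀ g, q ∣ symbolOp F (u * g)) : C q ∣ F := by
  induction m generalizing F with
  | zero =>
    rw [eq_C_of_isHomogeneous_zero _ hF, symbolOp_C] at h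
    rw [eq_C_of_isHomogeneous_zero _ hF]
    refine map_dvd C (hq _ ?_)
    have := h 1
    rwa [mul_one, mulOp, LinearMap.mulLeft_apply, mul_comm] at this
  | succ m ih =>
    refine C_dvd_of_C_dvd_pderiv K _ hF fun i => ih (by simpa using hF.pderiv) fun g => ?_
    -- Applying the hypothesis to `X i * g` and commuting `X i` out shows that `pderiv i F`
    -- satisfies the same hypothesis.
    have h1 := h (linForm K (Pi.single i (1 : K)) * g)
    rw [mul_left_comm, symbolOp_linForm_mul, dirDeriv_single] at h1
    exact (dvd_add_right ((h g).mul_left _)).1 h1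

/-- A differential operator of order `m` kills products of fewer than `m` linear forms. -/
theorem symbolOp_prod_linForm_eq_zero {ι : Type*} (v : ι → Fin n → K) (s : Finset ι) {m : ℕ}
    {F : MvPolynomial (Fin n) (MvPolynomial (Fin n) K)} (hF : F.IsHomogeneous m)
    (hm : s.card < m) : symbolOp F (∏ i ∈ s, linForm K (v i)) = 0 := by
  classical
  induction s using Finset.induction_on generalizing m F with
  | empty =>
    rw [F.as_sum, map_sum, LinearMap.sum_apply]
    refine Finset.sum_eq_zero fun α hα => ?_
    rw [symbolOp_monomial, LinearMap.smul_apply, Finset.prod_empty, partialPow_one_eq_zero,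
      smul_zero]
    rintro rfl
    have := hF (mem_support_iff.1 hα)
    simp at this hm
    omega
  | insert a s ha ih =>
    rw [Finset.card_insert_of_notMem ha] at hm
    rw [Finset.prod_insert ha, symbolOp_linForm_mul, ih hF (by omega),
      ih (isHomogeneous_dirDeriv _ hF _) (by omega), mul_zero, add_zero]

/-- The symbol `∑ x_i ξ_i` of the Euler derivation. -/
noncomputable def eulerSymbol (K : Type*) [Field K] (n : ℕ) :
    MvPolynomial (Fin n) (MvPolynomial (Fin n) K) :=
  ∑ i, C (X i) * X i

theorem isHomogeneous_eulerSymbol : (eulerSymbol K n).IsHomogeneous 1 :=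
  IsHomogeneous.sum _ _ _ fun i _ => (isHomogeneous_X _ i).C_mul _

theorem dirDeriv_eulerSymbol (v : Fin n → K) :
    dirDeriv (MvPolynomial (Fin n) K) v (eulerSymbol K n) = C (linForm K v) := by
  rw [eulerSymbol, linForm_apply, map_sum, map_sum]
  refine Finset.sum_congr rfl fun i _ => ?_
  rw [dirDeriv_C_mul, dirDeriv_X, MvPolynomial.algebraMap_apply, algebraMap_eq, ← map_mul,
    smul_eq_C_mul, mul_comm]

/-- This is the multinomial theorem; writing `ε_m` as a power of one symbol makes its derivatives
immediate. -/
theorem symbolOp_eulerSymbol_pow (m : ℕ) [CharZero K] :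
    symbolOp (eulerSymbol K n ^ m) = eulerOp K n m := by
  classical
  rw [eulerSymbol, Finset.sum_pow_eq_sum_piAntidiag, map_sum, eulerOp]
  refine Finset.sum_nbij' (fun k => Finsupp.equivFunOnFinite.symm k) (fun α => ⇑α)
    (fun k hk => ?_) (fun α hα => ?_) (fun k _ => rfl) (fun α _ => by ext; rfl) fun k hk => ?_
  · simpa [Finset.mem_piAntidiag, Finset.mem_finsuppAntidiag] using hk
  · simpa [Finset.mem_piAntidiag, Finset.mem_finsuppAntidiag] using hα
  · set α : Fin n →₀ ℕ := Finsupp.equivFunOnFinite.symm k with hα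
    have hk' : k = α := rfl
    have hsum : ∑ i, k i = m := (Finset.mem_piAntidiag.1 hk).1
    have h0 : ∏ i, ((k i)! : K) ≠ 0 :=
      Finset.prod_ne_zero_iff.2 fun i _ => Nat.cast_ne_zero.2 (Nat.factorial_ne_zero _)
    have hc : (m ! : K) / ∏ i, ((k i)! : K) = (Nat.multinomial Finset.univ k : K) := by
      rw [div_eq_iff h0, ← hsum, ← Nat.multinomial_spec, mul_comm]
      push_cast
      rfl
    have hm1 : ∏ i, (X i : MvPolynomial (Fin n) K) ^ k i = monomial α 1 := by
      rw [monomial_eq, C_1, one_mul, Finsupp.prod_fintype _ _ fun i => pow_zero _, hk']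
    have hm2 : ∏ i, (X i : MvPolynomial (Fin n) (MvPolynomial (Fin n) K)) ^ k i = monomial α 1 := by
      rw [monomial_eq, C_1, one_mul, Finsupp.prod_fintype _ _ fun i => pow_zero _, hk']
    simp_rw [mul_pow, Finset.prod_mul_distrib, ← map_pow, ← map_prod, hm1, hm2]
    rw [← map_natCast (C : MvPolynomial (Fin n) K →+* _), ← mul_assoc, ← map_mul,
      symbolOp_C_mul, symbolOp_monomial, one_smul, ← hk', hc, ← map_natCast (C : K →+* _),
      C_mul_monomial, mul_one]

/-- Pull out one factor: the undifferentiated term vanishes, since the order exceeds the number of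
remaining factors, and the derivative of the symbol contributes the order times that factor. -/
theorem eulerOp_prod_linForm [CharZero K] {ι : Type*} (v : ι → Fin n → K) (s : Finset ι) :
    eulerOp K n s.card (∏ i ∈ s, linForm K (v i)) = (s.card ! : K) • ∏ i ∈ s, linForm K (v i) := by
  classical
  simp_rw [← symbolOp_eulerSymbol_pow]
  induction s using Finset.induction_on with
  | empty => rw [Finset.card_empty, pow_zero, ← C_1, symbolOp_C]; simp [mulOp]
  | insert a s ha ih =>
    rw [Finset.prod_insert ha, Finset.card_insert_of_notMem ha, symbolOp_linForm_mul,
      symbolOp_prod_linForm_eq_zero v s (m := s.card + 1) (by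
        simpa using (isHomogeneous_eulerSymbol (K := K) (n := n)).pow (s.card + 1)) (by omega),
      mul_zero, zero_add, dirDeriv_pow, Nat.add_sub_cancel, dirDeriv_eulerSymbol, mul_right_comm,
      ← map_mul, symbolOp_C_mul, LinearMap.smul_apply, ih, Nat.factorial_succ, smul_eq_mul,
      smul_eq_C_mul, smul_eq_C_mul]
    push_cast
    simp only [map_mul, map_add, map_natCast, map_one]
    ring

end SymbolOperators

/-! ### Logarithmic symbols and their generators -/

section LogarithmicSymbols

variable {K : Type*} [Field K] {n : ℕ} {ι : Type*}

/-- Every `n` of the vectors `v_i`, `i ∈ A`, form a basis of `K^n`. -/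
def IsGeneralPosition (v : ι → Fin n → K) (A : Finset ι) : Prop :=
  n ≤ A.card ∧ ∀ B ⊆ A, B.card = n → LinearIndepOn K v (B : Set ι)

theorem IsGeneralPosition.notMem_span {v : ι → Fin n → K} {A : Finset ι}
    (hv : IsGeneralPosition v A) {B : Finset ι} (hB : B ⊆ A) (hBn : B.card < n) {i : ι}
    (hi : i ∈ A) (hiB : i ∉ B) : v i ∉ Submodule.span K (v '' B) := by
  classical
  obtain ⟨B', hB1, hB2, hB3⟩ := Finset.exists_subsuperset_card_eq
    (Finset.insert_subset hi hB) (by rw [Finset.card_insert_of_notMem hiB]; omega) hv.1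
  have h := (hv.2 B' hB2 hB3).mono (Finset.coe_subset.2 hB1)
  rw [Finset.coe_insert, linearIndepOn_insert (by simpa using hiB)] at h
  exact h.2

theorem IsGeneralPosition.span_eq_top {v : ι → Fin n → K} {A : Finset ι}
    (hv : IsGeneralPosition v A) {B : Finset ι} (hB : B ⊆ A) (hBn : B.card = n) :
    Submodule.span K (v '' B) = ⊤ := by
  have h := hv.2 B hB hBn
  have h1 := LinearIndependent.span_eq_top_of_card_eq_finrank' h (by simp [hBn])
  rwa [← Set.image_eq_range] at h1

theorem IsGeneralPosition.ne_zero {v : ι → Fin n → K} {A : Finset ι}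
    (hv : IsGeneralPosition v A) (hn : n ≠ 0) {i : ι} (hi : i ∈ A) : v i ≠ 0 := by
  intro h
  refine hv.notMem_span (Finset.empty_subset A) (by simpa using Nat.pos_of_ne_zero hn) hi
    (Finset.notMem_empty i) ?_
  rw [h]; exact Submodule.zero_mem _

theorem IsGeneralPosition.prime {v : ι → Fin n → K} {A : Finset ι}
    (hv : IsGeneralPosition v A) (hn : n ≠ 0) {i : ι} (hi : i ∈ A) : Prime (linForm K (v i)) :=
  prime_linForm (hv.ne_zero hn hi)

theorem IsGeneralPosition.not_dvd {v : ι → Fin n → K} {A : Finset ι}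
    (hv : IsGeneralPosition v A) (hn : 2 ≤ n) {i j : ι} (hi : i ∈ A) (hj : j ∈ A) (hij : i ≠ j) :
    ¬ linForm K (v i) ∣ linForm K (v j) := by
  refine not_linForm_dvd_linForm ?_
  have := hv.notMem_span (Finset.singleton_subset_iff.2 hi) (by rw [Finset.card_singleton]; omega)
    hj (by simpa using hij.symm)
  simpa using this

theorem IsGeneralPosition.prod_dvd {v : ι → Fin n → K} {A : Finset ι}
    (hv : IsGeneralPosition v A) (hn : 2 ≤ n) {s : Finset ι} (hs : s ⊆ A)
    {f : MvPolynomial (Fin n) K} (h : ∀ i ∈ s, linForm K (v i) ∣ f) :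
    ∏ i ∈ s, linForm K (v i) ∣ f := by
  refine Finset.prod_dvd_of_isRelPrime (fun i hi j hj hij => ?_) h
  exact ((hv.prime (by omega) (hs hi)).irreducible.isRelPrime_iff_not_dvd).2
    (hv.not_dvd hn (hs hi) (hs hj) hij)

/-- Nonzero vectors orthogonal to `n - 1` of the `v_i`. -/
def IsOrthogonalFamily (v : ι → Fin n → K) (A : Finset ι) (d : Finset ι → Fin n → K) : Prop :=
  ∀ T ⊆ A, T.card = n - 1 → d T ≠ 0 ∧ ∀ i ∈ T, d T ⬝ᵥ v i = 0

/-- Otherwise `d T` would be orthogonal to `n` of the vectors, which form a basis. -/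
theorem IsOrthogonalFamily.dotProduct_ne_zero {v : ι → Fin n → K} {A : Finset ι}
    (hv : IsGeneralPosition v A) (hn : n ≠ 0) {d : Finset ι → Fin n → K}
    (hd : IsOrthogonalFamily v A d) {T : Finset ι} (hT : T ⊆ A) (hTn : T.card = n - 1) {i : ι}
    (hi : i ∈ A) (hiT : i ∉ T) : d T ⬝ᵥ v i ≠ 0 := by
  classical
  intro h
  refine (hd T hT hTn).1 (dotProduct_eq_zero _ fun w => ?_)
  have hw : w ∈ Submodule.span K (v '' ↑(insert i T)) := by
    rw [hv.span_eq_top (Finset.insert_subset hi hT)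
      (by rw [Finset.card_insert_of_notMem hiT]; omega)]
    trivial
  induction hw using Submodule.span_induction with
  | mem x hx =>
    obtain ⟨j, hj, rfl⟩ := hx
    rcases Finset.mem_insert.1 hj with rfl | hj
    · exact h
    · exact (hd T hT hTn).2 j hj
  | zero => simp
  | add x y _ _ hx hy => rw [dotProduct_add, hx, hy, add_zero]
  | smul a x _ hx => rw [dotProduct_smul, hx, smul_zero]

/-- The symbols of order `k` that are logarithmic along the `v_i`, `i ∈ U`, and killed by the
derivatives along the `v_i`, `i ∈ E`. -/
noncomputable def logSymbols (v : ι → Fin n → K) (U E : Finset ι) (k : ℕ) :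
    Submodule (MvPolynomial (Fin n) K) (MvPolynomial (Fin n) (MvPolynomial (Fin n) K)) where
  carrier := {F | F.IsHomogeneous k ∧
    (∀ i ∈ U, C (linForm K (v i)) ∣ dirDeriv (MvPolynomial (Fin n) K) (v i) F) ∧
    ∀ i ∈ E, dirDeriv (MvPolynomial (Fin n) K) (v i) F = 0}
  add_mem' := fun ha hb => ⟨ha.1.add hb.1,
    fun i hi => by rw [map_add]; exact dvd_add (ha.2.1 i hi) (hb.2.1 i hi),
    fun i hi => by rw [map_add, ha.2.2 i hi, hb.2.2 i hi, add_zero]⟩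
  zero_mem' := ⟨isHomogeneous_zero _ _ _, fun i _ => by simp, fun i _ => by simp⟩
  smul_mem' := fun f F hF => ⟨by rw [smul_eq_C_mul]; exact hF.1.C_mul f,
    fun i hi => by rw [smul_eq_C_mul, dirDeriv_C_mul]; exact (hF.2.1 i hi).mul_left _,
    fun i hi => by rw [smul_eq_C_mul, dirDeriv_C_mul, hF.2.2 i hi, mul_zero]⟩

theorem eulerSymbol_pow_mem_logSymbols (v : ι → Fin n → K) (U : Finset ι) (k : ℕ) :
    eulerSymbol K n ^ k ∈ logSymbols v U ∅ k := by
  refine ⟨by simpa using isHomogeneous_eulerSymbol.pow k, fun i _ => ?_, by simp⟩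
  rw [dirDeriv_pow, dirDeriv_eulerSymbol]
  exact dvd_mul_left _ _

variable [DecidableEq ι]

/-- The symbol of `P_T δ_T^k` relative to the arrangement indexed by `U`. -/
noncomputable def genSymbol (v : ι → Fin n → K) (d : Finset ι → Fin n → K) (U : Finset ι) (k : ℕ)
    (T : Finset ι) : MvPolynomial (Fin n) (MvPolynomial (Fin n) K) :=
  C (∏ i ∈ U \ T, linForm K (v i)) * linForm (MvPolynomial (Fin n) K) (d T) ^ k

variable {v : ι → Fin n → K} {A : Finset ι} {d : Finset ι → Fin n → K}

theorem dirDeriv_genSymbol (w : Fin n → K) (U : Finset ι) (k : ℕ) (T : Finset ι) :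
    dirDeriv (MvPolynomial (Fin n) K) w (genSymbol v d U (k + 1) T) =
      C (C (((k + 1 : ℕ) : K) * (d T ⬝ᵥ w))) * genSymbol v d U k T := by
  rw [genSymbol, dirDeriv_C_mul, dirDeriv_pow, dirDeriv_linForm, Nat.add_sub_cancel, genSymbol,
    MvPolynomial.algebraMap_apply, algebraMap_eq, map_mul C, map_mul C, ← map_natCast (C : K →+* MvPolynomial (Fin n) K)]
  ring

theorem genSymbol_mem_logSymbols (hd : IsOrthogonalFamily v A d) {U E T : Finset ι} (hET : E ⊆ T)
    (hTA : T ⊆ A) (hT : T.card = n - 1) (k : ℕ) :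
    genSymbol v d U k T ∈ logSymbols v U E k := by
  have h0 : ∀ i ∈ T, dirDeriv (MvPolynomial (Fin n) K) (v i) (genSymbol v d U k T) = 0 := by
    intro i hi
    rcases k with _ | k
    · rw [genSymbol, pow_zero, mul_one, dirDeriv_C]
    · rw [dirDeriv_genSymbol, (hd T hTA hT).2 i hi]; simp
  refine ⟨?_, fun i hi => ?_, fun i hi => h0 i (hET hi)⟩
  · have h := (isHomogeneous_linForm (MvPolynomial (Fin n) K) (d T)).pow k
    rw [one_mul] at h
    exact h.C_mul _
  · by_cases hiT : i ∈ T
    · rw [h0 i hiT]; exact dvd_zero _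
    · rw [genSymbol, dirDeriv_C_mul]
      exact (map_dvd C (Finset.dvd_prod_of_mem (fun i => linForm K (v i))
        (Finset.mem_sdiff.2 ⟨hi, hiT⟩))).mul_right _

/-- Dividing the derivative along `v_a` by the form of `v_a` gives a logarithmic symbol of the
arrangement without `a`. -/
theorem mem_logSymbols_of_dirDeriv_eq (hv : IsGeneralPosition v A) (hn : 2 ≤ n) {U E : Finset ι}
    (hU : U ⊆ A) {k : ℕ} {a : ι} (ha : a ∈ U)
    {F G : MvPolynomial (Fin n) (MvPolynomial (Fin n) K)} (hF : F ∈ logSymbols v U E (k + 1))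
    (hG : dirDeriv (MvPolynomial (Fin n) K) (v a) F = C (linForm K (v a)) * G) :
    G ∈ logSymbols v (U.erase a) E k := by
  have hp := hv.prime (by omega) (hU ha)
  have hpC : Prime (C (linForm K (v a)) : MvPolynomial (Fin n) (MvPolynomial (Fin n) K)) :=
    (prime_C_iff _).2 hp
  -- Since directional derivatives commute, divisibility and vanishing pass from the derivatives of
  -- `F` to those of `G`, up to the factor `p_a`, which the other `p_i` do not divide.
  have hcomm : ∀ w : Fin n → K, C (linForm K (v a)) * dirDeriv (MvPolynomial (Fin n) K) w G =
      dirDeriv (MvPolynomial (Fin n) K) (v a) (dirDeriv (MvPolynomial (Fin n) K) w F) := by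
    intro w
    rw [← dirDeriv_C_mul, ← hG, dirDeriv_comm]
  refine ⟨?_, fun i hi => ?_, fun i hi => ?_⟩
  · have h := isHomogeneous_dirDeriv _ hF.1 (v a)
    rw [hG, Nat.add_sub_cancel] at h
    intro α hα
    refine h ?_
    rw [coeff_C_mul]
    exact mul_ne_zero hp.ne_zero hα
  · rw [Finset.mem_erase] at hi
    obtain ⟨H, hH⟩ := hF.2.1 i hi.2
    have h1 : C (linForm K (v i)) ∣ C (linForm K (v a)) * dirDeriv (MvPolynomial (Fin n) K) (v i) G := by
      rw [hcomm, hH, dirDeriv_C_mul]; exact dvd_mul_right _ _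
    refine (((prime_C_iff _).2 (hv.prime (by omega) (hU hi.2))).dvd_or_dvd h1).resolve_left fun h => ?_
    refine hv.not_dvd hn (hU hi.2) (hU ha) hi.1 ?_
    simpa using (C_dvd_iff_dvd_coeff _ _).1 h 0
  · have h1 := hcomm (v i)
    rw [hF.2.2 i hi, map_zero, mul_eq_zero] at h1
    exact h1.resolve_left hpC.ne_zero

/-- Combinations of the generators of the arrangement without `a` integrate along `v_a`. -/
theorem exists_mem_span_genSymbol [CharZero K] (hv : IsGeneralPosition v A) (hn : 2 ≤ n)
    (hd : IsOrthogonalFamily v A d) {U : Finset ι} (hU : U ⊆ A) {a : ι} (ha : a ∈ U)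
    {𝒯 : Set (Finset ι)} (h𝒯 : ∀ T ∈ 𝒯, T ⊆ U.erase a ∧ T.card = n - 1) {k : ℕ}
    {G : MvPolynomial (Fin n) (MvPolynomial (Fin n) K)}
    (hG : G ∈ Submodule.span (MvPolynomial (Fin n) K) (genSymbol v d (U.erase a) k '' 𝒯)) :
    ∃ F ∈ Submodule.span (MvPolynomial (Fin n) K) (genSymbol v d U (k + 1) '' 𝒯),
      dirDeriv (MvPolynomial (Fin n) K) (v a) F = C (linForm K (v a)) * G := by
  induction hG using Submodule.span_induction with
  | mem x hx =>
    obtain ⟨T, hT, rfl⟩ := hx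
    obtain ⟨hTU, hTn⟩ := h𝒯 T hT
    have haT : a ∉ T := fun h => Finset.notMem_erase a U (hTU h)
    set c : K := ((k + 1 : ℕ) : K) * (d T ⬝ᵥ v a) with hc
    have hc0 : c ≠ 0 := mul_ne_zero (Nat.cast_ne_zero.2 k.succ_ne_zero)
      (hd.dotProduct_ne_zero hv (by omega) ((hTU.trans (Finset.erase_subset a U)).trans hU) hTn
        (hU ha) haT)
    refine ⟨(C c⁻¹ : MvPolynomial (Fin n) K) • genSymbol v d U (k + 1) T,
      Submodule.smul_mem _ _ (Submodule.subset_span ⟨T, hT, rfl⟩), ?_⟩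
    have hgen : genSymbol v d U k T = C (linForm K (v a)) * genSymbol v d (U.erase a) k T := by
      rw [genSymbol, genSymbol, ← mul_assoc, ← map_mul, Finset.erase_sdiff_comm,
        Finset.mul_prod_erase _ (fun i => linForm K (v i)) (Finset.mem_sdiff.2 ⟨ha, haT⟩)]
    rw [smul_eq_C_mul, dirDeriv_C_mul, dirDeriv_genSymbol, ← hc, ← mul_assoc, ← map_mul, ← map_mul,
      inv_mul_cancel₀ hc0, map_one, map_one, one_mul, hgen]
  | zero => exact ⟨0, Submodule.zero_mem _, by simp⟩
  | add x y _ _ hx hy =>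
    obtain ⟨F, hF, hF'⟩ := hx
    obtain ⟨F₁, hF₁, hF₁'⟩ := hy
    exact ⟨F + F₁, Submodule.add_mem _ hF hF₁, by rw [map_add, hF', hF₁', mul_add]⟩
  | smul c x _ hx =>
    obtain ⟨F, hF, hF'⟩ := hx
    refine ⟨c • F, Submodule.smul_mem _ _ hF, ?_⟩
    rw [smul_eq_C_mul, dirDeriv_C_mul, hF', smul_eq_C_mul, mul_left_comm]

/-- The quotient of a derivative of a first-order symbol lies in the ideal of products. -/
theorem C_mem_span_genSymbol_zero (hv : IsGeneralPosition v A) {U E : Finset ι} (hU : U ⊆ A)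
    (hEU : E ⊆ U) (hE : E.Nonempty) (hEn : E.card < n - 1) (hUn : n ≤ U.card) {a : ι} (ha : a ∈ U)
    (haE : a ∉ E) {F : MvPolynomial (Fin n) (MvPolynomial (Fin n) K)} (hF : F ∈ logSymbols v U E 1)
    {f : MvPolynomial (Fin n) K}
    (hf : dirDeriv (MvPolynomial (Fin n) K) (v a) F = C (linForm K (v a)) * C f) :
    C f ∈ Submodule.span (MvPolynomial (Fin n) K)
      (genSymbol v d (U.erase a) 0 '' {T | E ⊆ T ∧ T ⊆ U.erase a ∧ T.card = n - 1}) := by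
  set s := U.erase a \ E with hs
  have hsU : s ⊆ U := Finset.sdiff_subset.trans (Finset.erase_subset a U)
  have has : a ∉ s := fun h => Finset.notMem_erase a U (Finset.sdiff_subset h)
  have hE0 := hE.card_pos
  have hEa : E ⊆ U.erase a := fun i hi => Finset.mem_erase.2 ⟨fun h => haE (h ▸ hi), hEU hi⟩
  have hsc : s.card = U.card - 1 - E.card := by
    rw [hs, Finset.card_sdiff_of_subset hEa, Finset.card_erase_of_mem ha]
  -- With this `d` the products have `U.card - n` factors, so their complements in `U.erase a` are
  -- exactly the sets `T ⊇ E` with `n - 1` elements.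
  have key := mem_span_prod_of_forall_mem (fun i => linForm K (v i)) s (n - E.card) ⊥
    (fun B hB hBc i hi hiB h hh => by
      rw [bot_sup_eq] at hh ⊢
      rw [← Function.comp_def, Set.image_comp] at hh ⊢
      exact mem_span_of_linForm_mul_mem (hv.notMem_span ((hB.trans hsU).trans hU) (by omega)
        (hU (hsU hi)) hiB) hh) f
    (fun B hB hBc => by
      rw [bot_sup_eq, ← Function.comp_def, Set.image_comp]
      refine mem_span_of_linForm_mul_mem (hv.notMem_span ((hB.trans hsU).trans hU) (by omega)
        (hU ha) fun h => has (hB h)) ?_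
      have hdis : Disjoint E B :=
        Finset.disjoint_left.2 fun i hi hiB => (Finset.mem_sdiff.1 (hB hiB)).2 hi
      -- `v a` is a combination of the vectors of `E`, along which `F` has derivative zero, and
      -- those of `B`, along which the derivative lies in the ideal of `B`. Hence `p_a f` lies in
      -- that ideal.
      have hspan := hv.span_eq_top (B := E ∪ B)
        (Finset.union_subset (hEU.trans hU) ((hB.trans hsU).trans hU))
        (by rw [Finset.card_union_of_disjoint hdis]; omega)
      set I : Ideal (MvPolynomial (Fin n) K) := Ideal.span (linForm K '' (v '' B)) with hI
      let N : Submodule (MvPolynomial (Fin n) K) (MvPolynomial (Fin n) (MvPolynomial (Fin n) K)) :=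
        (I.map (C : _ →+* MvPolynomial (Fin n) (MvPolynomial (Fin n) K))).restrictScalars _
      have h1 : dirDeriv (MvPolynomial (Fin n) K) (v a) F ∈ N := by
        refine dirDeriv_mem_of_mem_span _ N (s := v '' ↑(E ∪ B)) ?_ (hspan ▸ Submodule.mem_top)
        rintro _ ⟨i, hi, rfl⟩
        rcases Finset.mem_union.1 hi with hi | hi
        · rw [hF.2.2 i hi]; exact N.zero_mem
        · exact Ideal.mem_of_dvd _ (hF.2.1 i (hsU (hB hi)))
            (Ideal.mem_map_of_mem _ (Ideal.subset_span ⟨_, ⟨i, hi, rfl⟩, rfl⟩))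
      rw [hf, ← map_mul] at h1
      have h2 := mem_map_C_iff.1 h1 0
      rwa [coeff_zero_C] at h2)
  rw [bot_sup_eq] at key
  have hCmap : ∀ x ∈ Ideal.span {x | ∃ W ⊆ s, W.card = s.card + 1 - (n - E.card) ∧
      x = ∏ i ∈ W, linForm K (v i)}, C x ∈ Submodule.span (MvPolynomial (Fin n) K)
      (genSymbol v d (U.erase a) 0 '' {T | E ⊆ T ∧ T ⊆ U.erase a ∧ T.card = n - 1}) := by
    intro x hx
    induction hx using Submodule.span_induction with
    | mem x hx =>
      obtain ⟨W, hW, hWc, rfl⟩ := hx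
      have hWU : W ⊆ U.erase a := hW.trans Finset.sdiff_subset
      refine Submodule.subset_span ⟨U.erase a \ W, ⟨fun i hi => ?_, Finset.sdiff_subset, ?_⟩, ?_⟩
      · exact Finset.mem_sdiff.2 ⟨hEa hi, fun h => (Finset.mem_sdiff.1 (hW h)).2 hi⟩
      · rw [Finset.card_sdiff_of_subset hWU, Finset.card_erase_of_mem ha]
        omega
      · rw [genSymbol, pow_zero, mul_one, Finset.sdiff_sdiff_eq_self hWU]
    | zero => simp
    | add x y _ _ hx hy => rw [map_add]; exact Submodule.add_mem _ hx hy
    | smul c x _ hx =>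
      rw [smul_eq_mul, map_mul, ← smul_eq_C_mul]; exact Submodule.smul_mem _ _ hx
  exact hCmap f key

/-- A logarithmic symbol killed by `n - 1` of the derivatives is a multiple of a generator. -/
theorem mem_span_genSymbol_of_card_eq [CharZero K] (hv : IsGeneralPosition v A) (hn : 2 ≤ n)
    (hd : IsOrthogonalFamily v A d) {k : ℕ} {U E : Finset ι} (hU : U ⊆ A) (hEU : E ⊆ U)
    (hE : E.card = n - 1) (hUn : n ≤ U.card)
    {F : MvPolynomial (Fin n) (MvPolynomial (Fin n) K)} (hF : F ∈ logSymbols v U E (k + 1)) :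
    F ∈ Submodule.span (MvPolynomial (Fin n) K) {genSymbol v d U (k + 1) E} := by
  have hdot : ∀ i ∈ U \ E, d E ⬝ᵥ v i ≠ 0 := fun i hi =>
    hd.dotProduct_ne_zero hv (by omega) (hEU.trans hU) hE (hU (Finset.mem_sdiff.1 hi).1)
      (Finset.mem_sdiff.1 hi).2
  obtain ⟨a, ha⟩ : (U \ E).Nonempty := by
    rw [← Finset.card_pos, Finset.card_sdiff_of_subset hEU]; omega
  have hspan := hv.span_eq_top (B := insert a E)
    (Finset.insert_subset (hU (Finset.mem_sdiff.1 ha).1) (hEU.trans hU))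
    (by rw [Finset.card_insert_of_notMem (Finset.mem_sdiff.1 ha).2]; omega)
  rw [Finset.coe_insert, Set.image_insert_eq] at hspan
  obtain ⟨f, hf⟩ := exists_eq_C_mul_linForm_pow (MvPolynomial (Fin n) K) (s := v '' E) (d := d E)
    (w := v a) (by rintro _ ⟨i, hi, rfl⟩; exact (hd E (hEU.trans hU) hE).2 i hi) (hdot a ha) hspan
    hF.1 (by rintro _ ⟨i, hi, rfl⟩; exact hF.2.2 i hi)
  have hdvd : ∏ i ∈ U \ E, linForm K (v i) ∣ f := by
    refine hv.prod_dvd hn (Finset.sdiff_subset.trans hU) fun i hi => ?_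
    have h1 := hF.2.1 i (Finset.mem_sdiff.1 hi).1
    rw [hf, dirDeriv_C_mul, dirDeriv_pow, dirDeriv_linForm, MvPolynomial.algebraMap_apply] at h1
    -- Evaluating `ξ` at `v i` turns the power of the linear form of `d E` into a nonzero constant,
    -- leaving divisibility of `f` itself.
    have h2 := map_dvd (eval fun j => algebraMap K (MvPolynomial (Fin n) K) (v i j)) h1
    simp only [map_mul, map_pow, eval_C, eval_algebraMap_linForm] at h2
    have hu : IsUnit (((k + 1 : ℕ) : MvPolynomial (Fin n) K) *
        (algebraMap K (MvPolynomial (Fin n) K) (d E ⬝ᵥ v i)) ^ (k + 1 - 1) *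
        algebraMap K (MvPolynomial (Fin n) K) (d E ⬝ᵥ v i)) := by
      rw [← map_natCast (algebraMap K (MvPolynomial (Fin n) K)), ← map_pow, ← map_mul, ← map_mul]
      exact (IsUnit.mk0 _ (mul_ne_zero (mul_ne_zero (Nat.cast_ne_zero.2 k.succ_ne_zero)
        (pow_ne_zero _ (hdot i hi))) (hdot i hi))).map _
    exact hu.dvd_mul_right.1 h2
  obtain ⟨g, rfl⟩ := hdvd
  refine Submodule.mem_span_singleton.2 ⟨g, ?_⟩
  rw [hf, genSymbol, smul_eq_C_mul, map_mul]
  ring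

/-- The integrate-and-subtract step, with the membership of the quotient left as the hypothesis
`hquot`. It is kept separate because `hquot` has two different proofs: in order one from star
configurations (order-zero logarithmic symbols are all of `S`), and in higher order from the
inductive hypothesis. The number `c` counts the elements still missing from `E`. -/
theorem logSymbols_le_span_of_quotient_mem [CharZero K] (hv : IsGeneralPosition v A) (hn : 2 ≤ n)
    (hd : IsOrthogonalFamily v A d) (k : ℕ)
    (hquot : ∀ {U E : Finset ι}, U ⊆ A → E ⊆ U → E.Nonempty → E.card < n - 1 → n + k ≤ U.card →
      ∀ {a}, a ∈ U → a ∉ E → ∀ {F G}, F ∈ logSymbols v U E (k + 1) →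
      dirDeriv (MvPolynomial (Fin n) K) (v a) F = C (linForm K (v a)) * G →
      G ∈ Submodule.span (MvPolynomial (Fin n) K)
        (genSymbol v d (U.erase a) k '' {T | E ⊆ T ∧ T ⊆ U.erase a ∧ T.card = n - 1}))
    (c : ℕ) {U E : Finset ι} (hU : U ⊆ A) (hEU : E ⊆ U)
    (hE : E.Nonempty) (hEc : E.card + c = n - 1) (hUk : n + k ≤ U.card) :
    logSymbols v U E (k + 1) ≤ Submodule.span (MvPolynomial (Fin n) K)
      (genSymbol v d U (k + 1) '' {T | E ⊆ T ∧ T ⊆ U ∧ T.card = n - 1}) := by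
  induction c generalizing E with
  | zero =>
    intro F hF
    refine Submodule.span_mono ?_ (mem_span_genSymbol_of_card_eq hv hn hd hU hEU hEc (by omega) hF)
    rintro _ rfl
    exact ⟨E, ⟨le_rfl, hEU, hEc⟩, rfl⟩
  | succ c ih =>
    intro F hF
    obtain ⟨a, ha⟩ : (U \ E).Nonempty := by
      rw [← Finset.card_pos, Finset.card_sdiff_of_subset hEU]; omega
    rw [Finset.mem_sdiff] at ha
    obtain ⟨G, hG⟩ := hF.2.1 a ha.1
    have hGs := hquot hU hEU hE (by omega) hUk ha.1 ha.2 hF hG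
    obtain ⟨F₁, hF₁, hF₁'⟩ := exists_mem_span_genSymbol hv hn hd hU ha.1
      (fun T hT => ⟨hT.2.1, hT.2.2⟩) hGs
    have hle : ∀ E', E ⊆ E' → ∀ V ⊆ U, Submodule.span (MvPolynomial (Fin n) K)
        (genSymbol v d U (k + 1) '' {T | E' ⊆ T ∧ T ⊆ V ∧ T.card = n - 1}) ≤
        Submodule.span (MvPolynomial (Fin n) K)
          (genSymbol v d U (k + 1) '' {T | E ⊆ T ∧ T ⊆ U ∧ T.card = n - 1}) := fun E' hE' V hV =>
      Submodule.span_mono (Set.image_mono fun T hT => ⟨hE'.trans hT.1, hT.2.1.trans hV, hT.2.2⟩)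
    have hF₁s := hle E le_rfl _ (Finset.erase_subset a U) hF₁
    have hF₁l : F₁ ∈ logSymbols v U E (k + 1) := by
      refine Submodule.span_le.2 ?_ hF₁s
      rintro _ ⟨T, hT, rfl⟩
      exact genSymbol_mem_logSymbols hd hT.1 (hT.2.1.trans hU) hT.2.2 _
    have hsub := Submodule.sub_mem _ hF hF₁l
    -- `F₁` has the same derivative along `v a` as `F` and is still killed along `E`, so `F - F₁` is
    -- killed along `insert a E`.
    have h2 := ih (E := insert a E) (Finset.insert_subset ha.1 hEU) (Finset.insert_nonempty a E)
      (by rw [Finset.card_insert_of_notMem ha.2]; omega) (x := F - F₁)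
      ⟨hsub.1, hsub.2.1, fun i hi => by
        rcases Finset.mem_insert.1 hi with rfl | hi
        · rw [map_sub, hG, hF₁', sub_self]
        · exact hsub.2.2 i hi⟩
    have h3 := Submodule.add_mem _ (hle _ (Finset.subset_insert a E) U le_rfl h2) hF₁s
    rwa [sub_add_cancel] at h3

/-- Logarithmic symbols killed by some of the derivatives are generated by the `P_T δ_T^k`. -/
theorem logSymbols_le_span_of_nonempty [CharZero K] (hv : IsGeneralPosition v A) (hn : 2 ≤ n)
    (hd : IsOrthogonalFamily v A d) (k c : ℕ) {U E : Finset ι} (hU : U ⊆ A) (hEU : E ⊆ U)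
    (hE : E.Nonempty) (hEc : E.card + c = n - 1) (hUk : n + k ≤ U.card) :
    logSymbols v U E (k + 1) ≤ Submodule.span (MvPolynomial (Fin n) K)
      (genSymbol v d U (k + 1) '' {T | E ⊆ T ∧ T ⊆ U ∧ T.card = n - 1}) := by
  induction k generalizing c U E with
  | zero =>
    refine logSymbols_le_span_of_quotient_mem hv hn hd 0 ?_ c hU hEU hE hEc hUk
    intro U E hU hEU hE hEn hUn a ha haE F G hF hG
    have hG0 := (mem_logSymbols_of_dirDeriv_eq hv hn hU ha hF hG).1
    rw [eq_C_of_isHomogeneous_zero _ hG0] at hG ⊢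
    exact C_mem_span_genSymbol_zero hv hU hEU hE hEn hUn ha haE hF hG
  | succ k ihk =>
    refine logSymbols_le_span_of_quotient_mem hv hn hd (k + 1) ?_ c hU hEU hE hEc hUk
    intro U E hU hEU hE hEn hUn a ha haE F G hF hG
    exact ihk (n - 1 - E.card) ((Finset.erase_subset a U).trans hU)
      (fun i hi => Finset.mem_erase.2 ⟨fun h => haE (h ▸ hi), hEU hi⟩) hE (by omega)
      (by rw [Finset.card_erase_of_mem ha]; omega) (mem_logSymbols_of_dirDeriv_eq hv hn hU ha hF hG)

/-- Logarithmic symbols are generated by the power of the Euler symbol and the `P_T δ_T^k` for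
which `T` meets a given set of `k` indices. -/
theorem logSymbols_le_span_sup [CharZero K] (hv : IsGeneralPosition v A) (hn : 2 ≤ n)
    (hd : IsOrthogonalFamily v A d) {U M : Finset ι} (hU : U ⊆ A) (hMU : M ⊆ U)
    (hUk : n + M.card ≤ U.card) :
    logSymbols v U ∅ M.card ≤ Submodule.span (MvPolynomial (Fin n) K)
      (genSymbol v d U M.card '' {T | T ⊆ U ∧ T.card = n - 1 ∧ ∃ i ∈ T, i ∈ M}) ⊔
      Submodule.span (MvPolynomial (Fin n) K) {eulerSymbol K n ^ M.card} := by
  obtain ⟨k, hk⟩ : ∃ k, M.card = k := ⟨_, rfl⟩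
  rw [hk] at hUk ⊢
  induction k generalizing U M with
  | zero =>
    intro F hF
    refine Submodule.mem_sup_right (Submodule.mem_span_singleton.2 ⟨coeff 0 F, ?_⟩)
    rw [pow_zero, smul_eq_C_mul, mul_one, ← eq_C_of_isHomogeneous_zero _ hF.1]
  | succ k ih =>
    intro F hF
    obtain ⟨a, haM⟩ : M.Nonempty := Finset.card_pos.1 (by omega)
    have haU := hMU haM
    obtain ⟨G, hG⟩ := hF.2.1 a haU
    have hGs := ih ((Finset.erase_subset a U).trans hU) (Finset.erase_subset_erase a hMU)
      (by rw [Finset.card_erase_of_mem haU]; omega) (by rw [Finset.card_erase_of_mem haM]; omega)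
      (mem_logSymbols_of_dirDeriv_eq hv hn hU haU hF hG)
    obtain ⟨G₁, hG₁, G₂, hG₂, rfl⟩ := Submodule.mem_sup.1 hGs
    obtain ⟨c, rfl⟩ := Submodule.mem_span_singleton.1 hG₂
    obtain ⟨F₁, hF₁, hF₁'⟩ := exists_mem_span_genSymbol hv hn hd hU haU
      (fun T hT => ⟨hT.1, hT.2.1⟩) hG₁
    -- Differentiating the `(k+1)`-st power of the Euler symbol along `v a` gives `(k+1) p_a` times
    -- its `k`-th power; `b` cancels this `k + 1`.
    set b : MvPolynomial (Fin n) K := C (((k + 1 : ℕ) : K)⁻¹) with hb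
    have hbk : b * ((k + 1 : ℕ) : MvPolynomial (Fin n) K) = 1 := by
      rw [hb, ← map_natCast (C : K →+* MvPolynomial (Fin n) K), ← map_mul,
        inv_mul_cancel₀ (Nat.cast_ne_zero.2 k.succ_ne_zero), map_one]
    have hF₁s : F₁ ∈ Submodule.span (MvPolynomial (Fin n) K)
        (genSymbol v d U (k + 1) '' {T | T ⊆ U ∧ T.card = n - 1 ∧ ∃ i ∈ T, i ∈ M}) := by
      refine Submodule.span_mono (Set.image_mono ?_) hF₁
      rintro T ⟨hT, hTn, i, hi, hiM⟩
      exact ⟨hT.trans (Finset.erase_subset a U), hTn, i, hi, Finset.mem_of_mem_erase hiM⟩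
    have hF₁l : F₁ ∈ logSymbols v U ∅ (k + 1) := by
      refine Submodule.span_le.2 ?_ hF₁s
      rintro _ ⟨T, hT, rfl⟩
      exact genSymbol_mem_logSymbols hd (Finset.empty_subset T) (hT.1.trans hU) hT.2.1 _
    have hF₂l := Submodule.smul_mem _ (c * b) (eulerSymbol_pow_mem_logSymbols v U (k + 1))
    have hsub := Submodule.sub_mem _ (Submodule.sub_mem _ hF hF₁l) hF₂l
    -- What remains is killed along `v a`, so only sets `T` containing `a` occur; these meet `M`
    -- because `a ∈ M`.
    have h2 := logSymbols_le_span_of_nonempty hv hn hd k (n - 2) (E := {a}) hU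
      (Finset.singleton_subset_iff.2 haU) (Finset.singleton_nonempty a)
      (by rw [Finset.card_singleton]; omega) (by omega)
      (x := F - F₁ - (c * b) • eulerSymbol K n ^ (k + 1))
      ⟨hsub.1, hsub.2.1, fun i hi => by
        rw [Finset.mem_singleton.1 hi, map_sub, map_sub, hG, hF₁', smul_eq_C_mul, smul_eq_C_mul,
          dirDeriv_C_mul, dirDeriv_pow, dirDeriv_eulerSymbol, Nat.add_sub_cancel, map_mul C c b]
        have hbk' := congrArg (C : _ → MvPolynomial (Fin n) (MvPolynomial (Fin n) K)) hbk
        rw [map_mul, C_1] at hbk'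
        linear_combination (- C c * eulerSymbol K n ^ k * C (linForm K (v a))) * hbk'⟩
    have h3 : F - F₁ - (c * b) • eulerSymbol K n ^ (k + 1) ∈
        Submodule.span (MvPolynomial (Fin n) K)
          (genSymbol v d U (k + 1) '' {T | T ⊆ U ∧ T.card = n - 1 ∧ ∃ i ∈ T, i ∈ M}) := by
      refine Submodule.span_mono (Set.image_mono ?_) h2
      rintro T ⟨haT, hT, hTn⟩
      exact ⟨hT, hTn, a, Finset.singleton_subset_iff.1 haT, haM⟩
    refine Submodule.mem_sup.2 ⟨_, Submodule.add_mem _ h3 hF₁s, _, Submodule.smul_mem _ (c * b)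
      (Submodule.mem_span_singleton_self _), ?_⟩
    abel

end LogarithmicSymbols

/-! ### From arrangements to symbols; separating the generators -/

section Arrangement

variable {K : Type*} [Field K] {n : ℕ}

/-- The homogeneous operators preserving the ideal of a product of linear forms are those whose
symbols are logarithmic. -/
theorem idealizer_inf_homogeneousOps_eq_map [CharZero K] {ι : Type*} {v : ι → Fin n → K}
    {A : Finset ι} (hv : IsGeneralPosition v A) (hn : 2 ≤ n) (m : ℕ) :
    idealizer (Ideal.span {∏ i ∈ A, linForm K (v i)}) ⊓ homogeneousOps K n m =
      (logSymbols v A ∅ m).map symbolOp := by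
  classical
  refine le_antisymm ?_ ?_
  · rintro θ ⟨⟨-, hθ⟩, hθm⟩
    rw [homogeneousOps_eq_map] at hθm
    obtain ⟨F, hF, rfl⟩ := hθm
    rw [SetLike.mem_coe, mem_homogeneousSubmodule] at hF
    refine ⟨F, ⟨hF, fun a ha => ?_, by simp⟩, rfl⟩
    have hpa := hv.prime (by omega) ha
    refine C_dvd_of_symbolOp_mul (u := ∏ i ∈ A.erase a, linForm K (v i)) (fun f hf => ?_)
      (isHomogeneous_dirDeriv _ hF (v a)) fun g => ?_
    · refine (hpa.dvd_or_dvd hf).resolve_left fun h => ?_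
      obtain ⟨i, hi, hd⟩ := (hpa.dvd_finsetProd_iff _).1 h
      rw [Finset.mem_erase] at hi
      exact hv.not_dvd hn ha hi.2 hi.1.symm hd
    -- Commuting only the factor `p_a` out of `Q g` shows that `∂_{v_a} F` sends multiples of `Q /
    -- p_a` into the ideal of `p_a`.
    · have h1 := hθ ((∏ i ∈ A, linForm K (v i)) * g)
        (Ideal.mul_mem_right _ _ (Ideal.mem_span_singleton_self _))
      rw [Ideal.mem_span_singleton] at h1
      have h2 := (Finset.dvd_prod_of_mem (fun i => linForm K (v i)) ha).trans h1
      rw [← Finset.mul_prod_erase A (fun i => linForm K (v i)) ha, mul_assoc,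
        symbolOp_linForm_mul] at h2
      exact (dvd_add_right (dvd_mul_right _ _)).1 h2
  · rintro _ ⟨F, hF, rfl⟩
    refine ⟨⟨symbolOp_mem_weylAlgebra F, fun g hg => ?_⟩, ?_⟩
    · rw [Ideal.mem_span_singleton] at hg ⊢
      refine hv.prod_dvd hn le_rfl fun a ha => ?_
      obtain ⟨f, rfl⟩ := (Finset.dvd_prod_of_mem (fun i => linForm K (v i)) ha).trans hg
      obtain ⟨G, hG⟩ := hF.2.1 a ha
      rw [symbolOp_linForm_mul, hG, symbolOp_C_mul, LinearMap.smul_apply, smul_eq_mul]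
      exact dvd_add (dvd_mul_right _ _) (dvd_mul_right _ _)
    · rw [SetLike.mem_coe, homogeneousOps_eq_map]
      exact ⟨F, hF.1, rfl⟩

theorem symbolOp_linForm_pow_linForm_pow (d v : Fin n → K) (m : ℕ) :
    symbolOp (linForm (MvPolynomial (Fin n) K) d ^ m) (linForm K v ^ m) =
      C ((m ! : K) * (d ⬝ᵥ v) ^ m) := by
  induction m with
  | zero => rw [pow_zero, ← C_1, symbolOp_C]; simp [mulOp]
  | succ m ih =>
    have h0 := symbolOp_prod_linForm_eq_zero (fun _ : ℕ => v) (Finset.range m) (m := m + 1)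
      (F := linForm (MvPolynomial (Fin n) K) d ^ (m + 1))
      (by simpa using (isHomogeneous_linForm (MvPolynomial (Fin n) K) d).pow (m + 1)) (by simp)
    rw [Finset.prod_const, Finset.card_range] at h0
    rw [pow_succ' (linForm K v), symbolOp_linForm_mul, h0, mul_zero, zero_add, dirDeriv_pow,
      dirDeriv_linForm, Nat.add_sub_cancel, MvPolynomial.algebraMap_apply, mul_right_comm,
      ← map_mul, symbolOp_C_mul, LinearMap.smul_apply, ih, algebraMap_eq, smul_eq_mul,
      ← map_natCast (C : K →+* MvPolynomial (Fin n) K), ← map_mul, ← map_mul, Nat.factorial_succ]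
    push_cast
    congr 1
    ring

theorem eq_linForm_of_isHomogeneous {f : MvPolynomial (Fin n) K} (hf : f.IsHomogeneous 1) :
    f = linForm K fun i => coeff (Finsupp.single i 1) f := by
  have h := hf.sum_X_mul_pderiv
  rw [one_smul] at h
  conv_lhs => rw [← h]
  rw [linForm_apply]
  refine Finset.sum_congr rfl fun i _ => ?_
  have h1 : pderiv i f = C (coeff 0 (pderiv i f)) :=
    eq_C_of_isHomogeneous_zero _ (by simpa using hf.pderiv)
  rw [h1, coeff_pderiv, smul_eq_C_mul, mul_comm]
  simp

/-- If `n` normal vectors did not span, a nonzero functional vanishing on them would give a nonzero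
point in the intersection of their hyperplanes. -/
theorem isGeneralPosition_of_isGenericArrangement {A : Finset (Submodule K (Fin n → K))}
    (hgen : IsGenericArrangement A) (hn : n ≤ A.card) {v : Submodule K (Fin n → K) → Fin n → K}
    (hv : ∀ H ∈ A, ∀ x, x ∈ H ↔ v H ⬝ᵥ x = 0) : IsGeneralPosition v A := by
  classical
  refine ⟨hn, fun B hB hBn => ?_⟩
  refine linearIndependent_of_top_le_span_of_card_eq_finrank ?_ (by simp [hBn])
  by_contra hlt
  rw [← Set.image_eq_range] at hlt
  obtain ⟨f, hf, hle⟩ := Submodule.exists_le_ker_of_lt_top _ (lt_top_iff_ne_top.2 fun h =>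
    hlt h.ge)
  have hfx : ∀ w, f w = w ⬝ᵥ fun i => f (Pi.single i 1) := by
    intro w
    conv_lhs => rw [pi_eq_sum_univ' w]
    simp [dotProduct]
  have h0 : (fun i => f (Pi.single i 1)) ∈ B.inf id := by
    rw [Submodule.mem_finsetInf]
    intro H hH
    rw [id, hv H (hB hH), ← hfx]
    exact hle (Submodule.subset_span ⟨H, hH, rfl⟩)
  rw [hgen B hB hBn, Submodule.mem_bot] at h0
  exact hf (LinearMap.ext fun w => by rw [hfx, h0, dotProduct_zero, LinearMap.zero_apply])

theorem exists_isOrthogonalFamily {A : Finset (Submodule K (Fin n → K))}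
    {p : Submodule K (Fin n → K) → MvPolynomial (Fin n) K}
    {v : Submodule K (Fin n → K) → Fin n → K} (hpv : ∀ H ∈ A, p H = linForm K (v H))
    {δ : Finset (Submodule K (Fin n → K)) → Module.End K (MvPolynomial (Fin n) K)}
    (hδ : ∀ T ⊆ A, T.card = n - 1 → IsDirection p T (δ T)) :
    ∃ d, IsOrthogonalFamily v A d ∧
      ∀ T ⊆ A, T.card = n - 1 → δ T = ∑ i, d T i • partialOp K i := by
  classical
  have h : ∀ T, ∃ d : Fin n → K, T ⊆ A → T.card = n - 1 → δ T = ∑ i, d i • partialOp K i := by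
    intro T
    by_cases hT : T ⊆ A ∧ T.card = n - 1
    · obtain ⟨d, hd⟩ := (Submodule.mem_span_range_iff_exists_fun K).1 (hδ T hT.1 hT.2).1
      exact ⟨d, fun _ _ => hd.symm⟩
    · exact ⟨0, fun h1 h2 => absurd ⟨h1, h2⟩ hT⟩
  choose d hd using h
  refine ⟨d, fun T hT hTn => ⟨fun h0 => (hδ T hT hTn).2.1 ?_, fun H hH => ?_⟩, hd⟩
  · rw [hd T hT hTn, h0]; simp
  · have h1 := (hδ T hT hTn).2.2 H hH
    rw [hd T hT hTn, hpv H (hT hH), ← pow_one (∑ i, d T i • partialOp K i),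
      ← symbolOp_linForm_pow, ← pow_one (linForm K (v H)), symbolOp_linForm_pow_linForm_pow] at h1
    simpa using h1

theorem coProd_smul_pow_eq_symbolOp [DecidableEq (Submodule K (Fin n → K))]
    {A : Finset (Submodule K (Fin n → K))}
    {p : Submodule K (Fin n → K) → MvPolynomial (Fin n) K}
    {v : Submodule K (Fin n → K) → Fin n → K} (hpv : ∀ H ∈ A, p H = linForm K (v H))
    {d : Finset (Submodule K (Fin n → K)) → Fin n → K} {T : Finset (Submodule K (Fin n → K))}
    {θ : Module.End K (MvPolynomial (Fin n) K)} (hθ : θ = ∑ i, d T i • partialOp K i) (m : ℕ) :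
    coProd A p T • θ ^ m = symbolOp (genSymbol v d A m T) := by
  rw [genSymbol, symbolOp_C_mul, symbolOp_linForm_pow, hθ, coProd]
  congr 1
  refine Finset.prod_congr (by congr; exact Subsingleton.elim _ _) fun H hH => hpv H (Finset.mem_sdiff.1 hH).1

/-- The operators sending `u` to a polynomial vanishing at `x`. -/
noncomputable def vanishingOps (x : Fin n → K) (u : MvPolynomial (Fin n) K) :
    Submodule (MvPolynomial (Fin n) K) (Module.End K (MvPolynomial (Fin n) K)) where
  carrier := {θ | eval x (θ u) = 0}
  add_mem' := fun {a b} (ha : eval x (a u) = 0) (hb : eval x (b u) = 0) => by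
    change eval x ((a + b) u) = 0
    rw [LinearMap.add_apply, map_add, ha, hb, add_zero]
  zero_mem' := by simp
  smul_mem' := fun c θ (hθ : eval x (θ u) = 0) => by
    change eval x ((c • θ) u) = 0
    rw [LinearMap.smul_apply, smul_eq_mul, map_mul, hθ, mul_zero]

/-- Evaluation at the direction of `T` separates the generator of `T` from all others. -/
theorem exists_vanishingOps [CharZero K] {ι : Type*} [DecidableEq ι] {v : ι → Fin n → K}
    {A : Finset ι} {d : Finset ι → Fin n → K} (hv : IsGeneralPosition v A) (hn : 2 ≤ n)
    (hd : IsOrthogonalFamily v A d) (m : ℕ) {T : Finset ι} (hT : T ⊆ A) (hTn : T.card = n - 1) :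
    ∃ N : Submodule (MvPolynomial (Fin n) K) (Module.End K (MvPolynomial (Fin n) K)),
      symbolOp (genSymbol v d A m T) ∉ N ∧
      ∀ T' ⊆ A, T'.card = n - 1 → T' ≠ T → symbolOp (genSymbol v d A m T') ∈ N := by
  have hAn := hv.1
  obtain ⟨a, ha⟩ : (A \ T).Nonempty := by
    rw [← Finset.card_pos, Finset.card_sdiff_of_subset hT]; omega
  have hne : ∀ i ∈ A \ T, d T ⬝ᵥ v i ≠ 0 := fun i hi =>
    hd.dotProduct_ne_zero hv (by omega) hT hTn (Finset.mem_sdiff.1 hi).1 (Finset.mem_sdiff.1 hi).2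
  refine ⟨vanishingOps (d T) (linForm K (v a) ^ m), fun h => ?_, fun T' _ hTn' hne' => ?_⟩
  · change eval _ _ = 0 at h
    rw [genSymbol, symbolOp_C_mul, LinearMap.smul_apply, symbolOp_linForm_pow_linForm_pow,
      smul_eq_mul, map_mul, eval_C, map_prod] at h
    refine mul_ne_zero (Finset.prod_ne_zero_iff.2 fun i hi => ?_)
      (mul_ne_zero (Nat.cast_ne_zero.2 m.factorial_ne_zero) (pow_ne_zero _ (hne a ha))) h
    rw [eval_linForm, dotProduct_comm]
    exact hne i hi
  · change eval _ _ = 0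
    obtain ⟨i, hi, hi'⟩ : ∃ i ∈ T, i ∉ T' := by
      by_contra! h
      exact hne' (Finset.eq_of_subset_of_card_le h (by omega)).symm
    rw [genSymbol, symbolOp_C_mul, LinearMap.smul_apply, smul_eq_mul, map_mul, map_prod,
      Finset.prod_eq_zero (Finset.mem_sdiff.2 ⟨hT hi, hi'⟩), zero_mul]
    rw [eval_linForm, dotProduct_comm]
    exact (hd T hT hTn).2 i hi

/-- Pull out the factor of a common element of `T` and `M`: the symbol has zero derivative along it,
and too few factors remain for the order of the operator. -/
theorem symbolOp_genSymbol_prod_eq_zero {ι : Type*} [DecidableEq ι] {v : ι → Fin n → K}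
    {A : Finset ι} {d : Finset ι → Fin n → K} (hd : IsOrthogonalFamily v A d) {M T : Finset ι}
    (hT : T ⊆ A) (hTn : T.card = n - 1) {a : ι} (haT : a ∈ T) (haM : a ∈ M) :
    symbolOp (genSymbol v d A M.card T) (∏ i ∈ M, linForm K (v i)) = 0 := by
  have h := genSymbol_mem_logSymbols hd (U := A) le_rfl hT hTn M.card
  rw [← Finset.mul_prod_erase M (fun i => linForm K (v i)) haM, symbolOp_linForm_mul, h.2.2 a haT,
    symbolOp_prod_linForm_eq_zero v (M.erase a) h.1 (Finset.card_erase_lt_of_mem haM)]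
  simp

end Arrangement

/-! ### The decomposition and the minimality of the generators -/

theorem mainTheorem3 {K : Type*} [Field K] [CharZero K] (n r m : ℕ) (hn : 2 ≤ n)
    (A : Finset (Submodule K (Fin n → K))) (hA : IsCentralArrangement A)
    (hr : A.card = r) (hnr : n ≤ r) (hgen : IsGenericArrangement A)
    (p : Submodule K (Fin n → K) → MvPolynomial (Fin n) K)
    (hp : ∀ H ∈ A, IsDefiningForm H (p H))
    (δ : Finset (Submodule K (Fin n → K)) → Module.End K (MvPolynomial (Fin n) K))
    (hδ : ∀ T ⊆ A, T.card = n - 1 → IsDirection p T (δ T))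
    (hm : m < r - n + 1)
    (M : Finset (Submodule K (Fin n → K))) (hMA : M ⊆ A) (hM : M.card = m) :
    -- `D^{(m)}(A) = Ξ^{(m)}(A) ⊕ S ε_m`
    (arrangementOps A p m =
        xiModule A p m M ⊔ Submodule.span (MvPolynomial (Fin n) K) {eulerOp K n m} ∧
      Disjoint (xiModule A p m M)
        (Submodule.span (MvPolynomial (Fin n) K) {eulerOp K n m})) ∧
    -- `D^{(m)}(A) = (∑_T S P_T δ_T^m) ⊕ S ε_m`
    (arrangementOps A p m =
        (⨆ T ∈ meetingSets A M,
          Submodule.span (MvPolynomial (Fin n) K) {coProd A p T • δ T ^ m}) ⊔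
          Submodule.span (MvPolynomial (Fin n) K) {eulerOp K n m} ∧
      Disjoint
        (⨆ T ∈ meetingSets A M,
          Submodule.span (MvPolynomial (Fin n) K) {coProd A p T • δ T ^ m})
        (Submodule.span (MvPolynomial (Fin n) K) {eulerOp K n m})) ∧
    -- the operators `P_T δ_T^m` are pairwise distinct and minimally generate `Ξ^{(m)}(A)`
    Set.InjOn (fun T => coProd A p T • δ T ^ m) (meetingSets A M) ∧
    Minimal (fun G : Set (Module.End K (MvPolynomial (Fin n) K)) =>
        Submodule.span (MvPolynomial (Fin n) K) G = xiModule A p m M)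
      ((fun T => coProd A p T • δ T ^ m) '' meetingSets A M) := by
  classical
  set v : Submodule K (Fin n → K) → Fin n → K := fun H i => coeff (Finsupp.single i 1) (p H)
  have hpv : ∀ H ∈ A, p H = linForm K (v H) := fun H hH => eq_linForm_of_isHomogeneous (hp H hH).1
  have hv : IsGeneralPosition v A := isGeneralPosition_of_isGenericArrangement hgen (hr ▸ hnr)
    fun H hH x => by rw [(hp H hH).2, hpv H hH, eval_linForm]
  obtain ⟨d, hd, hδd⟩ := exists_isOrthogonalFamily hpv hδ
  have hW : ∀ T ⊆ A, T.card = n - 1 →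
      coProd A p T • δ T ^ m = symbolOp (genSymbol v d A m T) :=
    fun T hT hTn => coProd_smul_pow_eq_symbolOp hpv (hδd T hT hTn) m
  have hD : arrangementOps A p m = (logSymbols v A ∅ m).map symbolOp := by
    rw [arrangementOps, Finset.prod_congr rfl hpv, idealizer_inf_homogeneousOps_eq_map hv hn]
  have hMp : ∏ H ∈ M, p H = ∏ H ∈ M, linForm K (v H) :=
    Finset.prod_congr rfl fun H hH => hpv H (hMA hH)
  have hspan : (⨆ T ∈ meetingSets A M,
      Submodule.span (MvPolynomial (Fin n) K) {coProd A p T • δ T ^ m}) =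
      Submodule.span (MvPolynomial (Fin n) K)
        ((fun T => coProd A p T • δ T ^ m) '' meetingSets A M) := by
    rw [Submodule.span_eq_iSup_of_singleton_spans, iSup_image]
  have hspan_le : Submodule.span (MvPolynomial (Fin n) K)
      ((fun T => coProd A p T • δ T ^ m) '' meetingSets A M) ≤ xiModule A p m M := by
    rw [Submodule.span_le]
    rintro _ ⟨T, ⟨hT, hTn, a, haT, haM⟩, rfl⟩
    refine ⟨?_, ?_⟩
    · rw [hD]
      exact ⟨_, genSymbol_mem_logSymbols hd (Finset.empty_subset T) hT hTn m, (hW T hT hTn).symm⟩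
    · rw [hMp]
      change (coProd A p T • δ T ^ m) _ = 0
      rw [hW T hT hTn, ← hM]
      exact symbolOp_genSymbol_prod_eq_zero hd hT hTn haT haM
  have hε : Submodule.span (MvPolynomial (Fin n) K) {eulerOp K n m} ≤ arrangementOps A p m := by
    rw [Submodule.span_singleton_le_iff_mem, hD]
    exact ⟨_, eulerSymbol_pow_mem_logSymbols v A m, symbolOp_eulerSymbol_pow m⟩
  have hΞD : xiModule A p m M ≤ arrangementOps A p m := fun θ hθ => hθ.1
  have hdisj : Disjoint (xiModule A p m M)
      (Submodule.span (MvPolynomial (Fin n) K) {eulerOp K n m}) := by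
    rw [Submodule.disjoint_def]
    intro θ hθ hθε
    obtain ⟨c, rfl⟩ := Submodule.mem_span_singleton.1 hθε
    have h1 := hθ.2
    rw [hMp, LinearMap.smul_apply, ← hM, eulerOp_prod_linForm, smul_eq_mul, mul_eq_zero,
      smul_eq_zero, Finset.prod_eq_zero_iff] at h1
    rcases h1 with rfl | h1 | ⟨H, hH, h1⟩
    · exact zero_smul _ _
    · exact absurd h1 (Nat.cast_ne_zero.2 M.card.factorial_ne_zero)
    · exact absurd h1 (hv.prime (by omega) (hMA hH)).ne_zero
  have hDle : arrangementOps A p m ≤ Submodule.span (MvPolynomial (Fin n) K)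
      ((fun T => coProd A p T • δ T ^ m) '' meetingSets A M) ⊔
        Submodule.span (MvPolynomial (Fin n) K) {eulerOp K n m} := by
    rw [hD]
    subst hM
    -- The bound on `m` enters here, as `n + M.card ≤ A.card`: each drop in order deletes a
    -- hyperplane, and at least `n` must remain.
    refine (Submodule.map_mono
      (logSymbols_le_span_sup hv hn hd le_rfl hMA (by omega))).trans ?_
    rw [Submodule.map_sup, Submodule.map_span, Submodule.map_span, Set.image_singleton,
      symbolOp_eulerSymbol_pow]
    refine sup_le_sup_right (Submodule.span_mono ?_) _
    rintro _ ⟨_, ⟨T, hT, rfl⟩, rfl⟩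
    exact ⟨T, hT, hW T hT.1 hT.2.1⟩
  have hΞ : Submodule.span (MvPolynomial (Fin n) K)
      ((fun T => coProd A p T • δ T ^ m) '' meetingSets A M) = xiModule A p m M :=
    -- By modularity, a submodule of `Ξ` that together with `ε_m` spans all of `D^{(m)}(A)` equals
    -- `Ξ`, since `Ξ` meets `S ε_m` trivially.
    eq_of_le_of_inf_le_of_sup_le hspan_le (hdisj.eq_bot.trans_le bot_le)
      (sup_le (hΞD.trans hDle) le_sup_right)
  have hDeq : arrangementOps A p m = xiModule A p m M ⊔
      Submodule.span (MvPolynomial (Fin n) K) {eulerOp K n m} :=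
    le_antisymm (hΞ ▸ hDle) (sup_le hΞD hε)
  have hsep : ∀ T ∈ meetingSets A M, ∃ N : Submodule (MvPolynomial (Fin n) K)
      (Module.End K (MvPolynomial (Fin n) K)), coProd A p T • δ T ^ m ∉ N ∧
        ∀ T' ∈ meetingSets A M, T' ≠ T → coProd A p T' • δ T' ^ m ∈ N := by
    intro T hT
    obtain ⟨N, hN, hN'⟩ := exists_vanishingOps hv hn hd m hT.1 hT.2.1
    refine ⟨N, by rwa [hW T hT.1 hT.2.1], fun T' hT' hne => ?_⟩
    rw [hW T' hT'.1 hT'.2.1]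
    exact hN' T' hT'.1 hT'.2.1 hne
  rw [hspan, hΞ]
  refine ⟨⟨hDeq, hdisj⟩, ⟨hDeq, hdisj⟩, fun T hT T' hT' h => ?_, hΞ, fun G hG hGle => ?_⟩
  · by_contra hne
    obtain ⟨N, hN, hN'⟩ := hsep T hT
    have h' : coProd A p T • δ T ^ m = coProd A p T' • δ T' ^ m := h
    exact hN (h' ▸ hN' T' hT' (Ne.symm hne))
  · rintro _ ⟨T, hT, rfl⟩
    by_contra hTG
    obtain ⟨N, hN, hN'⟩ := hsep T hT
    have hGN : Submodule.span (MvPolynomial (Fin n) K) G ≤ N := by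
      rw [Submodule.span_le]
      intro θ hθ
      obtain ⟨T', hT', rfl⟩ := hGle hθ
      exact hN' T' hT' fun h => hTG (h ▸ hθ)
    refine hN (hGN ?_)
    rw [hG]
    exact hspan_le (Submodule.subset_span ⟨T, hT, rfl⟩)
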